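/- Let $\mathbb{F}$ be a field. A $\Sigma\Pi\Sigma(k,d)$ circuit over $\mathbb{F}$ in variables $x_1,\dots,x_n$ is a formal sum $C=\sum_{i=1}^k T_i$ of $k$ multiplication terms $T_i=c_i\prod_{j=1}^d \ell_{i,j}$, where $c_i\in\mathbb{F}^*$ and each $\ell_{i,j}$ is a nonzero linear form (homogeneous of degree $1$) in $x_1,\dots,x_n$. The circuit $C$ is an identity if $\sum_{i=1}^k T_i$ is the zero polynomial; it is simple if no nonzero linear form divides all of $T_1,\dots,T_k$; it is minimal if $\sum_{i\in S}T_i\neq 0$ for every nonempty proper subset $S\subset\{1,\dots,k\}$. The rank of $C$ is the dimension of the $\mathbb{F}$-span of all the forms $\ell_{i,j}$, and the independent-fanin of $C$ is the largest size of a set $I\subseteq\{1,\dots,k\}$ such that the polynomials $T_i$, $i\in I$, are linearly independent over $\mathbb{F}$. A finite set $S\subset\mathbb{F}^N$ of nonzero vectors, no two of which are scalar multiples of each other, is called $\mathrm{SG}_r$-closed if for every set $V\subseteq S$ of $r$ linearly independent vectors the linear span of $V$ contains at least $r+1$ vectors of $S$. Let $\mathrm{SG}_r(\mathbb{F},m)$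 be the largest possible rank (dimension of the span) of an $\mathrm{SG}_r$-closed set of at most $m$ vectors in $\mathbb{F}^N$, over all $N$ (and $0$ if there is no such set, which happens only for $r=0$). Theorem. Assume $|\mathbb{F}|>d$, and let $C$ be a simple and minimal $\Sigma\Pi\Sigma(k,d)$ identity over $\mathbb{F}$ with independent-fanin $k'$. Then $$\mathrm{rank}(C)\le 2k^2+(k-k')\cdot \mathrm{SG}_{k'}(\mathbb{F},d),$$ and also $$\mathrm{rank}(C)\le 2k^2+k\cdot \mathrm{SG}_{k}(\mathbb{F},d).$$ -/

import Mathlib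

namespace DepthThree

noncomputable section

/-- The linear form `a₁x₁ + ⋯ + aₙxₙ` with coefficient vector `a`. -/
def linForm {F : Type*} [Field F] {n : ℕ} (a : Fin n → F) : MvPolynomial (Fin n) F :=
  ∑ i, MvPolynomial.C (a i) * MvPolynomial.X i

/-- A `ΣΠΣ(k,d)` circuit in `n` variables over `F`: `k` multiplication terms, each a nonzero
scalar times a list of `d` nonzero linear forms (given by their coefficient vectors). -/
structure Circuit (F : Type*) [Field F] (n k d : ℕ) where
  coeff : Fin k → F
  coeff_ne_zero : ∀ i, coeff i ≠ 0
  form : Fin k → Fin d → (Fin n → F)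
  form_ne_zero : ∀ i j, form i j ≠ 0

namespace Circuit

variable {F : Type*} [Field F] {n k d : ℕ}

/-- The polynomial computed by the `i`-th multiplication term. -/
def term (C : Circuit F n k d) (i : Fin k) : MvPolynomial (Fin n) F :=
  MvPolynomial.C (C.coeff i) * ∏ j, linForm (C.form i j)

/-- The circuit computes the zero polynomial. -/
def IsIdentity (C : Circuit F n k d) : Prop :=
  ∑ i, C.term i = 0

/-- No nonzero linear form divides all the terms. -/
def IsSimple (C : Circuit F n k d) : Prop :=
  ¬ ∃ a : Fin n → F, a ≠ 0 ∧ ∀ i, linForm a ∣ C.term i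

/-- No nonempty proper subset of the terms sums to zero. -/
def IsMinimal (C : Circuit F n k d) : Prop :=
  ∀ S : Finset (Fin k), S.Nonempty → S ≠ Finset.univ → ∑ i ∈ S, C.term i ≠ 0

/-- The rank of the set of all linear forms of the circuit. -/
def rank (C : Circuit F n k d) : ℕ :=
  Module.finrank F (Submodule.span F {a : Fin n → F | ∃ i j, C.form i j = a})

open scoped Classical in
/-- The independent-fanin: the largest size of a set `I` of indices such that the polynomials
`T i`, `i ∈ I`, are linearly independent. -/
def indFanin (C : Circuit F n k d) : ℕ :=
  (Finset.univ.filter fun I : Finset (Fin k) =>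
    LinearIndependent F (fun i : I => C.term i)).sup Finset.card

end Circuit

/-- A finite set `S` of nonzero vectors, no two of which are scalar multiples of each other, is
`SG_k`-closed if the span of any `k` linearly independent vectors of `S` contains at least
`k + 1` vectors of `S`. -/
def SGClosed {F : Type*} [Field F] {n : ℕ} (k : ℕ) (S : Finset (Fin n → F)) : Prop :=
  (∀ v ∈ S, v ≠ 0) ∧
  (∀ u ∈ S, ∀ v ∈ S, u ≠ v → ∀ c : F, u ≠ c • v) ∧
  ∀ V : Finset (Fin n → F), V ⊆ S → V.card = k →
    LinearIndependent F (fun v : V => (v : Fin n → F)) →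
    k + 1 ≤ {v : Fin n → F | v ∈ S ∧ v ∈ Submodule.span F (V : Set (Fin n → F))}.ncard

/-- `SG_k(F, m)`: the largest rank of an `SG_k`-closed set of at most `m` vectors in `F^n`, over
all `n`. Such a rank is at most `m`, so for `1 ≤ k` (where `∅` is `SG_k`-closed) this supremum is
attained. -/
def SG (F : Type*) [Field F] (k m : ℕ) : ℕ :=
  sSup {r : ℕ | ∃ (n : ℕ) (S : Finset (Fin n → F)), S.card ≤ m ∧ SGClosed k S ∧
    Module.finrank F (Submodule.span F (S : Set (Fin n → F))) = r}

end

end DepthThree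

/-!
Work modulo ideals generated by products of linear forms from a small subspace `K` (form ideals).
Modulo such an ideal a nonzero sum of products of forms can be turned into a nonzero multiple of one
of these products, at the cost of at most one dimension of `K` per product. Applied to complementary
subsums of a minimal identity, this makes two terms proportional and nonzero modulo a form ideal,
and comparing degrees after a shift along a functional vanishing on `K` shows that their forms match
modulo `K`, up to order and scalars. So the forms of all terms match modulo a subspace of dimension
at most `k ^ 2`, and enlarging it by at most `k ^ 2` further dimensions keeps a maximal independent
set of terms independent when only the factors inside the subspace are retained.

What is left are the directions of the forms modulo `K`. Each of them varies along some minimal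
relation between one term and the maximal independent ones: otherwise it would contribute the same
factor to all terms, contradicting simplicity. The directions varying along one relation are
Sylvester-Gallai closed. Indeed, if `m` independent ones spanned no further direction of this kind,
extracting the factors in the spans of subsets of them would make the inner parts of the terms
orthogonal to all products of their direction parts, which forces a proper subsum of the relation
between the inner parts to vanish.
-/

namespace DepthThree

noncomputable section

open MvPolynomial
open scoped Finset

section Perm

lemma exists_perm_of_card_fiber_eq {α β : Type*} [Fintype α] [DecidableEq β] {f g : α → β} (x₀ : β)
    (h : ∀ x ≠ x₀, #{j | f j = x} = #{j | g j = x}) :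
    ∃ σ : Equiv.Perm α, ∀ j, g (σ j) = f j := by
  classical
  have fiberEquiv (x : β) : Nonempty
      ({j : {j // f j ≠ x₀} // f j = x} ≃ {j : {j // g j ≠ x₀} // g j = x}) := by
    rcases eq_or_ne x x₀ with rfl | hx
    · have (f : α → β) : IsEmpty {j : {j // f j ≠ x} // f j = x} := ⟨fun j => j.1.2 j.2⟩
      exact ⟨Equiv.equivOfIsEmpty _ _⟩
    · have e : {j // f j = x} ≃ {j // g j = x} :=
        Fintype.equivOfCardEq (by rw [Fintype.card_subtype, Fintype.card_subtype, h x hx])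
      exact ⟨(Equiv.subtypeSubtypeEquivSubtype fun hj => hj ▸ hx).trans
        (e.trans (Equiv.subtypeSubtypeEquivSubtype fun hj => hj ▸ hx).symm)⟩
  let e : {j // f j ≠ x₀} ≃ {j // g j ≠ x₀} := Equiv.ofFiberEquiv fun x => (fiberEquiv x).some
  refine ⟨e.extendSubtype, fun j => ?_⟩
  by_cases hj : f j = x₀
  · exact (not_not.1 (e.extendSubtype_not_mem j (not_not.2 hj))).trans hj.symm
  · rw [e.extendSubtype_apply_of_mem j hj]
    exact Equiv.ofFiberEquiv_map (fun x => (fiberEquiv x).some) ⟨j, hj⟩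

end Perm

section Lines

variable (F : Type*) [Field F] {E : Type*} [AddCommGroup E] [Module F E]

/-- A representative of `v` up to nonzero scalars, the same for all nonzero multiples of `v`. It
stands for the line through `v` when `v ≠ 0`, and is `0` when `v = 0`. -/
def lineRep (v : E) : E := (Quotient.mk (MulAction.orbitRel Fˣ E) v).out

variable {F}

lemma lineRep_eq_lineRep_iff {v w : E} : lineRep F v = lineRep F w ↔ ∃ u : Fˣ, u • w = v := by
  rw [lineRep, lineRep, Quotient.out_inj, Quotient.eq, MulAction.orbitRel_apply,
    MulAction.mem_orbit_iff]

lemma exists_units_smul_eq_lineRep (v : E) : ∃ u : Fˣ, u • v = lineRep F v :=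
  MulAction.orbitRel_apply.1 (Quotient.mk_out (s := MulAction.orbitRel Fˣ E) v)

lemma lineRep_mem_iff {W : Submodule F E} {v : E} : lineRep F v ∈ W ↔ v ∈ W := by
  obtain ⟨u, hu⟩ := exists_units_smul_eq_lineRep (F := F) v
  rw [← hu, Units.smul_def, W.smul_mem_iff u.ne_zero]

lemma lineRep_eq_zero {v : E} : lineRep F v = 0 ↔ v = 0 := by
  simpa using lineRep_mem_iff (W := (⊥ : Submodule F E)) (v := v)

lemma lineRep_eq_of_eq_smul {v w : E} {c : F} (hv : lineRep F v ≠ 0)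
    (h : lineRep F v = c • lineRep F w) : lineRep F v = lineRep F w := by
  have hc : c ≠ 0 := by rintro rfl; simp [h] at hv
  obtain ⟨s, hs⟩ := exists_units_smul_eq_lineRep (F := F) v
  obtain ⟨t, ht⟩ := exists_units_smul_eq_lineRep (F := F) w
  refine lineRep_eq_lineRep_iff.2 ⟨s⁻¹ * (Units.mk0 c hc * t), ?_⟩
  rw [mul_smul, mul_smul, ht, inv_smul_eq_iff, hs, h, Units.smul_def, Units.val_mk0]

lemma mem_span_singleton_iff_lineRep {v w : E} :
    v ∈ Submodule.span F {w} ↔ v = 0 ∨ lineRep F v = lineRep F w := by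
  rw [Submodule.mem_span_singleton, lineRep_eq_lineRep_iff]
  constructor
  · rintro ⟨c, rfl⟩
    exact (eq_or_ne c 0).imp (by rintro rfl; simp) fun hc => ⟨Units.mk0 c hc, rfl⟩
  · rintro (rfl | ⟨u, rfl⟩)
    exacts [⟨0, by simp⟩, ⟨u, rfl⟩]

end Lines

section Relations

variable {F : Type*} [Field F] {E : Type*} [AddCommGroup E] [Module F E]

lemma exists_idempotent_ker_eq (K : Submodule F E) :
    ∃ q : E →ₗ[F] E, IsIdempotentElem q ∧ LinearMap.ker q = K := by
  obtain ⟨Z, hZ⟩ := K.exists_isCompl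
  exact ⟨Z.projection K hZ.symm, Submodule.isIdempotentElem_projection hZ.symm,
    Submodule.ker_projection hZ.symm⟩

lemma exists_functional_eq_one {K : Submodule F E} {a : E} (ha : a ∉ K) :
    ∃ l : E →ₗ[F] F, K ≤ LinearMap.ker l ∧ l a = 1 := by
  obtain ⟨f, hfa, hK⟩ := K.exists_le_ker_of_notMem ha
  exact ⟨(f a)⁻¹ • f, fun b hb => by simp [LinearMap.mem_ker.1 (hK hb)], by simp [hfa]⟩

lemma finrank_finset_sup_le [FiniteDimensional F E] {ι : Type*} (s : Finset ι)
    (W : ι → Submodule F E) :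
    Module.finrank F (s.sup W : Submodule F E) ≤ ∑ i ∈ s, Module.finrank F (W i) := by
  classical
  induction s using Finset.induction_on with
  | empty => simp
  | insert i s hi ih =>
    rw [Finset.sup_insert, Finset.sum_insert hi]
    exact (Submodule.finrank_add_le_finrank_add_finrank _ _).trans (by gcongr)

lemma finrank_comap_le {E E' : Type*} [AddCommGroup E] [Module F E] [FiniteDimensional F E]
    [AddCommGroup E'] [Module F E'] [FiniteDimensional F E'] (q : E →ₗ[F] E')
    (W : Submodule F E') :
    Module.finrank F (W.comap q) ≤ Module.finrank F W + Module.finrank F (LinearMap.ker q) := by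
  have h := LinearMap.lift_rank_comap_le (f := q) W
  simp only [← Module.finrank_eq_rank, Cardinal.lift_natCast] at h
  exact_mod_cast h

lemma finrank_sup_span_singleton_le [FiniteDimensional F E] (K : Submodule F E) (a : E) :
    Module.finrank F (K ⊔ Submodule.span F {a} : Submodule F E) ≤ Module.finrank F K + 1 :=
  (Submodule.finrank_add_le_finrank_add_finrank _ _).trans
    (Nat.add_le_add_left ((finrank_span_le_card {a}).trans (by simp)) _)

variable {ι : Type*} {I : Set ι} {t : ι → E} {j : ι} {γ : ι →₀ F}

/-- `γ` is a linear relation among `t j` and the vectors `t i` with `i ∈ I` that involves `t j`. If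
the `t i` with `i ∈ I` form a basis, it is unique up to scalars and expresses `t j` in that
basis. -/
structure IsFundamentalRelation (t : ι → E) (I : Set ι) (j : ι) (γ : ι →₀ F) : Prop where
  mem_support : j ∈ γ.support
  support_subset : (γ.support : Set ι) ⊆ insert j I
  linearCombination_eq_zero : Finsupp.linearCombination F t γ = 0

lemma exists_isFundamentalRelation (hj : j ∉ I) (h : t j ∈ Submodule.span F (t '' I)) :
    ∃ γ : ι →₀ F, IsFundamentalRelation t I j γ := by
  classical
  obtain ⟨c, hc, hcj⟩ := (Finsupp.mem_span_image_iff_linearCombination F).1 h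
  have hcj₀ : c j = 0 := Finsupp.notMem_support_iff.1 fun hj' => hj (hc hj')
  refine ⟨c - Finsupp.single j 1, by simp [hcj₀], fun i hi => ?_, by simp [hcj]⟩
  by_contra hi'
  obtain ⟨hij, hiI⟩ := not_or.1 hi'
  have hci : c i = 0 := Finsupp.notMem_support_iff.1 fun h => hiI (hc h)
  simp [hci, Ne.symm hij] at hi

lemma IsFundamentalRelation.sum_eq_zero (h : IsFundamentalRelation t I j γ) :
    ∑ i ∈ γ.support, γ i • t i = 0 := by
  rw [← h.linearCombination_eq_zero, Finsupp.linearCombination_apply, Finsupp.sum]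

lemma IsFundamentalRelation.sum_ne_zero (h : IsFundamentalRelation t I j γ)
    (hI : LinearIndepOn F t I) {B : Finset ι} (hB : B ⊂ γ.support) (hne : B.Nonempty) :
    ∑ i ∈ B, γ i • t i ≠ 0 := by
  classical
  have sum_ne_zero_of_notMem {B : Finset ι} (hB : B ⊆ γ.support) (hne : B.Nonempty)
      (hj : j ∉ B) : ∑ i ∈ B, γ i • t i ≠ 0 := fun h₀ => by
    obtain ⟨i, hi⟩ := hne
    have hBI : (B : Set ι) ⊆ I := fun i hi =>
      (h.support_subset (hB hi)).resolve_left fun hij => hj (hij ▸ hi)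
    exact Finsupp.mem_support_iff.1 (hB hi) (linearIndepOn_iff'.1 hI B γ hBI h₀ i hi)
  by_cases hj : j ∈ B
  · intro h₀
    have hsum := h.sum_eq_zero
    rw [← Finset.sum_sdiff hB.1, h₀, add_zero] at hsum
    exact sum_ne_zero_of_notMem Finset.sdiff_subset (Finset.sdiff_nonempty.2 hB.2)
      (fun hj' => (Finset.mem_sdiff.1 hj').2 hj) hsum
  · exact sum_ne_zero_of_notMem hB.1 hne hj

lemma IsFundamentalRelation.mem_span (h : IsFundamentalRelation t I j γ) {J : Set ι}
    (hJ : ∀ i ∈ γ.support, i ∈ I → i ∈ J) : t j ∈ Submodule.span F (t '' J) := by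
  classical
  have hsum := h.sum_eq_zero
  rw [← Finset.add_sum_erase _ _ h.mem_support] at hsum
  rw [← Submodule.smul_mem_iff _ (Finsupp.mem_support_iff.1 h.mem_support),
    eq_neg_of_add_eq_zero_left hsum]
  refine neg_mem (sum_mem fun i hi => Submodule.smul_mem _ _ (Submodule.subset_span ?_))
  obtain ⟨hij, hi⟩ := Finset.mem_erase.1 hi
  exact Set.mem_image_of_mem t (hJ i hi ((h.support_subset hi).resolve_left hij))

lemma eq_of_forall_isFundamentalRelation [Fintype ι] {X : Type*} {Γ : ι → ι →₀ F} {g : ι → X}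
    (hI : LinearIndepOn F t I) (hsum : ∑ i, t i = 0)
    (hmin : ∀ A : Finset ι, A.Nonempty → A ≠ Finset.univ → ∑ i ∈ A, t i ≠ 0)
    (hΓ : ∀ j ∉ I, IsFundamentalRelation t I j (Γ j))
    (hg : ∀ j ∉ I, ∀ i ∈ (Γ j).support, g i = g j) (e e' : ι) : g e = g e' := by
  classical
  have mem_span_level (J : Set ι) (hJ : ∀ i i', g i = g i' → i' ∈ J → i ∈ J) (i : ι)
      (hi : i ∈ J) : t i ∈ Submodule.span F (t '' (I ∩ J)) := by
    by_cases hiI : i ∈ I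
    · exact Submodule.subset_span (Set.mem_image_of_mem t ⟨hiI, hi⟩)
    · exact (hΓ i hiI).mem_span fun i' hi' hi'I => ⟨hi'I, hJ i' i (hg i hiI i' hi') hi⟩
  by_contra hne
  -- Since `∑ i ∈ A, t i = -∑ i ∈ Aᶜ, t i` lies in the span of the basis vectors on the level set
  -- `A` and in the span of those off it, it vanishes.
  let A : Finset ι := {i | g i = g e}
  have hdisj : Disjoint (Submodule.span F (t '' (I ∩ A))) (Submodule.span F (t '' (I ∩ ↑Aᶜ))) := by
    refine ((linearIndepOn_union_iff ?_).1 (hI.mono (Set.union_subset ?_ ?_))).2.2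
    · exact (Set.disjoint_left.2 fun i hi hi' => by simp_all).mono
        Set.inter_subset_right Set.inter_subset_right
    all_goals exact Set.inter_subset_left
  have hA : ∑ i ∈ A, t i ∈ Submodule.span F (t '' (I ∩ A)) :=
    sum_mem fun i hi => mem_span_level _ (fun i i' h h' => by simp_all [A]) i hi
  have hAc : ∑ i ∈ Aᶜ, t i ∈ Submodule.span F (t '' (I ∩ ↑Aᶜ)) :=
    sum_mem fun i hi => mem_span_level _ (fun i i' h h' => by simp_all [A]) i hi
  rw [← Finset.sum_add_sum_compl A] at hsum
  refine hmin A ⟨e, by simp [A]⟩ (fun hAu => hne ?_) (Submodule.disjoint_def.1 hdisj _ hA ?_)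
  · exact (Finset.mem_filter.1 (hAu ▸ Finset.mem_univ e' : e' ∈ A)).2.symm
  · rw [eq_neg_of_add_eq_zero_left hsum]
    exact neg_mem hAc

end Relations

section Orthogonality

variable {L ι κ : Type*} [Field L]

/-- The span of all products `∏ s ∈ B, θ s` with `B ⊆ U`. -/
def prodSpan (θ : κ → ι → L) (U : Finset κ) : Submodule L (ι → L) :=
  Submodule.span L ((fun B => ∏ s ∈ B, θ s) '' {B : Finset κ | B ⊆ U})

lemma prod_mem_prodSpan (θ : κ → ι → L) {B U : Finset κ} (hB : B ⊆ U) :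
    ∏ s ∈ B, θ s ∈ prodSpan θ U :=
  Submodule.subset_span (Set.mem_image_of_mem _ hB)

lemma one_mem_prodSpan (θ : κ → ι → L) (U : Finset κ) : 1 ∈ prodSpan θ U := by
  simpa using prod_mem_prodSpan θ (Finset.empty_subset U)

lemma prodSpan_mono (θ : κ → ι → L) {U U' : Finset κ} (h : U ⊆ U') :
    prodSpan θ U ≤ prodSpan θ U' :=
  Submodule.span_mono (Set.image_mono fun _ hB => Finset.Subset.trans hB h)

lemma mul_mem_prodSpan_insert [DecidableEq κ] {θ : κ → ι → L} {U : Finset κ} {s : κ} (hs : s ∉ U)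
    {w : ι → L} (hw : w ∈ prodSpan θ U) : θ s * w ∈ prodSpan θ (insert s U) := by
  induction hw using Submodule.span_induction with
  | mem w hw =>
    obtain ⟨B, hB, rfl⟩ := hw
    simpa [Finset.prod_insert fun hsB => hs (hB hsB)] using
      prod_mem_prodSpan θ (Finset.insert_subset_insert s hB)
  | zero => simp
  | add v w _ _ hv hw => rw [mul_add]; exact add_mem hv hw
  | smul c v _ hv => rw [mul_smul_comm]; exact Submodule.smul_mem _ _ hv

open scoped Classical in
lemma indicator_level_mem_of_mul_mem [Finite ι] {W : Submodule L (ι → L)} {θ : ι → L} (hone : 1 ∈ W)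
    (hmul : ∀ w ∈ W, θ * w ∈ W) (c : L) : (fun i => if θ i = c then 1 else 0) ∈ W := by
  have := Fintype.ofFinite ι
  have pow_mem (m : ℕ) : θ ^ m ∈ W := by
    induction m with
    | zero => simpa using hone
    | succ m ih => simpa [pow_succ'] using hmul _ ih
  have aeval_mem (p : Polynomial L) : Polynomial.aeval θ p ∈ W := by
    rw [Polynomial.aeval_eq_sum_range]
    exact sum_mem fun m _ => W.smul_mem _ (pow_mem m)
  convert aeval_mem (Lagrange.interpolate (Finset.univ.image θ) id (Pi.single c 1)) using 1
  ext i
  have hi := Lagrange.eval_interpolate_at_node (Pi.single c (1 : L)) Function.injective_id.injOn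
    (Finset.mem_image_of_mem θ (Finset.mem_univ i))
  simpa [Polynomial.aeval_pi_apply, Pi.single_apply] using hi.symm

open scoped Classical in
lemma card_lt_finrank_prodSpan [Finite ι] [Nonempty ι] {θ : κ → ι → L} {U : Finset κ}
    (h : ∀ s ∈ U, ∃ c, (fun i => if θ s i = c then 1 else 0) ∉ prodSpan θ U) :
    #U < Module.finrank L (prodSpan θ U) := by
  induction U using Finset.induction_on with
  | empty =>
    refine Module.finrank_pos_iff_exists_ne_zero.2 ⟨⟨1, one_mem_prodSpan θ ∅⟩, ?_⟩
    simp [Subtype.ext_iff]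
  | insert s U hs ih =>
    have hle := prodSpan_mono θ (Finset.subset_insert s U)
    have hlt : prodSpan θ U < prodSpan θ (insert s U) := by
      refine lt_of_le_of_ne hle fun heq => ?_
      obtain ⟨c, hc⟩ := h s (Finset.mem_insert_self s U)
      exact hc (heq ▸ indicator_level_mem_of_mul_mem (one_mem_prodSpan θ U)
        (fun w hw => heq.symm ▸ mul_mem_prodSpan_insert hs hw) c)
    have hU := ih fun s' hs' => (h s' (Finset.mem_insert_of_mem hs')).imp fun c hc hc' =>
      hc (hle hc')
    rw [Finset.card_insert_of_notMem hs]
    exact (Nat.succ_lt_succ hU).trans_le (Submodule.finrank_lt_finrank_of_lt hlt)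

lemma exists_subset_sum_eq_zero_of_orthogonal [Fintype ι] {x : ι → L} (hx : x ≠ 0)
    {U : Finset κ} {θ : κ → ι → L} (hθ : ∀ s ∈ U, ∃ i i', θ s i ≠ θ s i')
    (hcard : Fintype.card ι ≤ #U + 1) (h : ∀ B ⊆ U, ∑ i, x i * ∏ s ∈ B, θ s i = 0) :
    ∃ A : Finset ι, A.Nonempty ∧ A ≠ Finset.univ ∧ ∑ i ∈ A, x i = 0 := by
  classical
  by_contra! hno
  obtain ⟨i₀, hi₀⟩ := Function.ne_iff.1 hx
  have : Nonempty ι := ⟨i₀⟩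
  have horth {w : ι → L} (hw : w ∈ prodSpan θ U) : ∑ i, w i * x i = 0 := by
    refine (Submodule.span_le (p := LinearMap.ker (Fintype.linearCombination L x))).2 ?_ hw
    rintro _ ⟨B, hB, rfl⟩
    simpa [Fintype.linearCombination_apply, mul_comm] using h B hB
  have hfinrank : #U < Module.finrank L (prodSpan θ U) := by
    refine card_lt_finrank_prodSpan fun s hs => ?_
    obtain ⟨i, i', hii'⟩ := hθ s hs
    refine ⟨θ s i, fun hmem => hno {e | θ s e = θ s i} ⟨i, by simp⟩ (fun huniv => ?_) ?_⟩
    · exact hii' (Finset.mem_filter.1 (huniv ▸ Finset.mem_univ i')).2.symm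
    · simpa [Finset.sum_filter] using horth hmem
  have htop : prodSpan θ U = ⊤ := Submodule.eq_top_of_finrank_eq <|
    (Submodule.finrank_le _).antisymm <| by simpa using hcard.trans hfinrank
  exact hi₀ (by simpa [Pi.single_apply] using horth (w := Pi.single i₀ 1) (htop ▸ trivial))

end Orthogonality

section Domain

variable {R ι κ : Type*} [CommRing R] [IsDomain R]

lemma exists_ssubset_sum_eq_zero_of_orthogonal {A : Finset ι} {x : ι → R} (hx : ∃ i ∈ A, x i ≠ 0)
    {U : Finset κ} {θ : κ → ι → R} (hθ : ∀ s ∈ U, ∃ i ∈ A, ∃ i' ∈ A, θ s i ≠ θ s i')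
    (hcard : #A ≤ #U + 1) (h : ∀ B ⊆ U, ∑ i ∈ A, x i * ∏ s ∈ B, θ s i = 0) :
    ∃ B ⊂ A, B.Nonempty ∧ ∑ i ∈ B, x i = 0 := by
  classical
  let φ := algebraMap R (FractionRing R)
  have hφ : Function.Injective φ := IsFractionRing.injective R (FractionRing R)
  have hsub (f : ι → R) (B : Finset A) : φ (∑ i ∈ B.map (.subtype _), f i) = ∑ i ∈ B, φ (f i) := by
    simp
  obtain ⟨i₀, hi₀A, hi₀⟩ := hx
  obtain ⟨B, hne, huniv, hB⟩ := exists_subset_sum_eq_zero_of_orthogonal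
    (x := fun i : A => φ (x i)) (U := U) (θ := fun s i => φ (θ s i))
    (Function.ne_iff.2 ⟨⟨i₀, hi₀A⟩, by simpa using hφ.ne hi₀⟩)
    (fun s hs => by
      obtain ⟨i, hi, i', hi', hii'⟩ := hθ s hs
      exact ⟨⟨i, hi⟩, ⟨i', hi'⟩, hφ.ne hii'⟩)
    (by simpa using hcard)
    (fun B hB => by
      rw [Finset.sum_coe_sort A fun i => φ (x i) * ∏ s ∈ B, φ (θ s i)]
      simpa using congrArg φ (h B hB))
  refine ⟨B.map (.subtype _), Finset.ssubset_iff_subset_ne.2 ⟨?_, fun hBA => ?_⟩,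
    hne.map, hφ ?_⟩
  · exact Finset.map_subtype_subset B
  · refine huniv (Finset.eq_univ_iff_forall.2 fun i => ?_)
    have hi : (i : ι) ∈ B.map (.subtype _) := by
      rw [hBA]; exact i.2
    simpa using hi
  · rw [hsub, hB, map_zero]

end Domain

variable {F : Type*} [Field F] {n : ℕ}

section LinearForms

/-- `linForm` as a linear map. -/
def linFormₗ : (Fin n → F) →ₗ[F] MvPolynomial (Fin n) F where
  toFun := linForm
  map_add' a b := by simp [linForm, add_mul, Finset.sum_add_distrib]
  map_smul' c a := by simp [linForm, smul_eq_C_mul, Finset.mul_sum, mul_assoc]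

lemma linForm_smul (c : F) (a : Fin n → F) : linForm (c • a) = c • linForm a :=
  map_smul linFormₗ c a

lemma linForm_eq_zero {a : Fin n → F} : linForm a = 0 ↔ a = 0 := by
  refine ⟨fun h => ?_, fun h => h ▸ map_zero linFormₗ⟩
  ext i
  simpa [linForm, coeff_sum, coeff_C_mul, coeff_X, Finsupp.single_left_inj] using
    congrArg (coeff (Finsupp.single i 1)) h

lemma isHomogeneous_linForm (a : Fin n → F) : (linForm a).IsHomogeneous 1 :=
  IsHomogeneous.sum _ _ _ fun i _ => isHomogeneous_C_mul_X (a i) i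

lemma isHomogeneous_prod_linForm {κ : Type*} (t : Finset κ) (a : κ → Fin n → F) :
    (∏ j ∈ t, linForm (a j)).IsHomogeneous #t := by
  simpa using IsHomogeneous.prod t _ _ fun j _ => isHomogeneous_linForm (a j)

lemma prod_linForm_ne_zero {κ : Type*} {t : Finset κ} {a : κ → Fin n → F}
    (ha : ∀ j ∈ t, a j ≠ 0) : ∏ j ∈ t, linForm (a j) ≠ 0 :=
  Finset.prod_ne_zero_iff.2 fun j hj => linForm_eq_zero.not.2 (ha j hj)

end LinearForms

section Shift

lemma natDegree_prod_linear_le {R κ : Type*} [CommSemiring R] (t : Finset κ) (b c : κ → R) :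
    (∏ j ∈ t, (Polynomial.C (c j) * Polynomial.X + Polynomial.C (b j))).natDegree ≤ #t :=
  (Polynomial.natDegree_prod_le _ _).trans <|
    (Finset.sum_le_card_nsmul t _ 1 fun _ _ => Polynomial.natDegree_linear_le).trans (by simp)

lemma coeff_card_prod_linear {R κ : Type*} [CommSemiring R] (t : Finset κ) (b c : κ → R) :
    (∏ j ∈ t, (Polynomial.C (c j) * Polynomial.X + Polynomial.C (b j))).coeff #t =
      ∏ j ∈ t, c j := by
  rw [← mul_one #t,
    Polynomial.coeff_prod_of_natDegree_le _ _ 1 fun _ _ => Polynomial.natDegree_linear_le]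
  simp

/-- The homomorphism into polynomials in a new variable `t` that sends each linear form `a` to
`a + w(a) t`. -/
def shift (w : (Fin n → F) →ₗ[F] MvPolynomial (Fin n) F) :
    MvPolynomial (Fin n) F →ₐ[F] Polynomial (MvPolynomial (Fin n) F) :=
  aeval fun i => Polynomial.C (w (Pi.single i 1)) * Polynomial.X + Polynomial.C (X i)

variable (w : (Fin n → F) →ₗ[F] MvPolynomial (Fin n) F)

lemma shift_linForm (a : Fin n → F) :
    shift w (linForm a) = Polynomial.C (w a) * Polynomial.X + Polynomial.C (linForm a) := by
  have hw : w a = ∑ i, a i • w (Pi.single i 1) := by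
    conv_lhs => rw [pi_eq_sum_univ' a, map_sum]
    simp_rw [map_smul]
  simp only [shift, linForm, hw, map_sum, map_mul, aeval_X, algHom_C, Finset.sum_mul, mul_add,
    Finset.sum_add_distrib, smul_eq_C_mul, Polynomial.algebraMap_apply, algebraMap_eq, mul_assoc]

lemma coeff_zero_shift (x : MvPolynomial (Fin n) F) : (shift w x).coeff 0 = x := by
  induction x using MvPolynomial.induction_on with
  | C c => simp [shift, Polynomial.algebraMap_apply, algebraMap_eq]
  | add x y hx hy => rw [map_add, Polynomial.coeff_add, hx, hy]
  | mul_X x i hx => rw [map_mul, Polynomial.mul_coeff_zero, hx]; simp [shift]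

open scoped Classical in
lemma coeff_shift_prod_linForm {κ : Type*} (t : Finset κ) (a : κ → Fin n → F) :
    (shift w (∏ j ∈ t, linForm (a j))).coeff #{j ∈ t | w (a j) ≠ 0} =
      (∏ j ∈ t with w (a j) = 0, linForm (a j)) * ∏ j ∈ t with w (a j) ≠ 0, w (a j) := by
  have hfixed : shift w (∏ j ∈ t with w (a j) = 0, linForm (a j)) =
      Polynomial.C (∏ j ∈ t with w (a j) = 0, linForm (a j)) := by
    rw [map_prod, map_prod]
    exact Finset.prod_congr rfl fun j hj => by
      rw [shift_linForm, (Finset.mem_filter.1 hj).2, map_zero, zero_mul, zero_add]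
  rw [← Finset.prod_filter_mul_prod_filter_not t (fun j => w (a j) = 0), map_mul, hfixed,
    Polynomial.coeff_C_mul, map_prod]
  simp only [shift_linForm, coeff_card_prod_linear]

end Shift

section FormIdeals

variable {K K' : Submodule F (Fin n → F)} {I : Ideal (MvPolynomial (Fin n) F)}

/-- An ideal generated by products of linear forms from the subspace `K`. -/
def IsFormIdeal (K : Submodule F (Fin n → F)) (I : Ideal (MvPolynomial (Fin n) F)) : Prop :=
  ∃ s : Set (MvPolynomial (Fin n) F), s ⊆ Submonoid.closure (linForm '' (K : Set (Fin n → F))) ∧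
    I = Ideal.span s

lemma isFormIdeal_bot (K : Submodule F (Fin n → F)) : IsFormIdeal K ⊥ :=
  ⟨∅, Set.empty_subset _, Ideal.span_empty.symm⟩

lemma prod_linForm_mem_closure {κ : Type*} {t : Finset κ} {a : κ → Fin n → F}
    (h : ∀ j ∈ t, a j ∈ K) :
    ∏ j ∈ t, linForm (a j) ∈ Submonoid.closure (linForm '' (K : Set (Fin n → F))) :=
  prod_mem fun j hj => Submonoid.subset_closure (Set.mem_image_of_mem _ (h j hj))

lemma IsFormIdeal.mono (h : IsFormIdeal K I) (hK : K ≤ K') : IsFormIdeal K' I := by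
  obtain ⟨s, hs, rfl⟩ := h
  exact ⟨s, hs.trans (Submonoid.closure_mono (Set.image_mono hK)), rfl⟩

lemma IsFormIdeal.sup_span_singleton (h : IsFormIdeal K I) (hK : K ≤ K')
    {p : MvPolynomial (Fin n) F} (hp : p ∈ Submonoid.closure (linForm '' (K' : Set (Fin n → F)))) :
    IsFormIdeal K' (I ⊔ Ideal.span {p}) := by
  obtain ⟨s, hs, rfl⟩ := h.mono hK
  exact ⟨s ∪ {p}, Set.union_subset hs (Set.singleton_subset_iff.2 hp), (Ideal.span_union _ _).symm⟩

lemma shift_eq_C_of_mem_closure {w : (Fin n → F) →ₗ[F] MvPolynomial (Fin n) F}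
    (hw : K ≤ LinearMap.ker w) {p : MvPolynomial (Fin n) F}
    (hp : p ∈ Submonoid.closure (linForm '' (K : Set (Fin n → F)))) :
    shift w p = Polynomial.C p := by
  induction hp using Submonoid.closure_induction with
  | mem p hp =>
    obtain ⟨a, ha, rfl⟩ := hp
    simp [shift_linForm, LinearMap.mem_ker.1 (hw ha)]
  | one => simp
  | mul p q _ _ hp hq => simp [hp, hq]

lemma IsFormIdeal.shift_mem_map (h : IsFormIdeal K I)
    {w : (Fin n → F) →ₗ[F] MvPolynomial (Fin n) F} (hw : K ≤ LinearMap.ker w)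
    {x : MvPolynomial (Fin n) F} (hx : x ∈ I) : shift w x ∈ I.map Polynomial.C := by
  obtain ⟨s, hs, rfl⟩ := h
  refine (Ideal.span_le (I := (Ideal.map Polynomial.C (Ideal.span s)).comap (shift w))).2
    (fun p hp => ?_) hx
  rw [SetLike.mem_coe, Ideal.mem_comap, shift_eq_C_of_mem_closure hw (hs hp)]
  exact Ideal.mem_map_of_mem _ (Ideal.subset_span hp)

attribute [local instance] MvPolynomial.gradedAlgebra in
lemma IsFormIdeal.isHomogeneous (h : IsFormIdeal K I) :
    I.IsHomogeneous (homogeneousSubmodule (Fin n) F) := by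
  obtain ⟨s, hs, rfl⟩ := h
  refine Ideal.homogeneous_span _ s fun p hp => ?_
  refine (Submonoid.closure_le (S := SetLike.homogeneousSubmonoid _)).2 ?_ (hs hp)
  rintro _ ⟨a, -, rfl⟩
  exact ⟨1, isHomogeneous_linForm a⟩

attribute [local instance] MvPolynomial.gradedAlgebra in
lemma exists_sub_smul_mem_of_mem_sup_span {σ R : Type*} [CommRing R]
    {I : Ideal (MvPolynomial σ R)} (hI : I.IsHomogeneous (homogeneousSubmodule σ R))
    {f g : MvPolynomial σ R} {d : ℕ} (hf : f.IsHomogeneous d) (hg : g.IsHomogeneous d)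
    (h : f ∈ I ⊔ Ideal.span {g}) : ∃ c : R, f - c • g ∈ I := by
  obtain ⟨y, hy, z, hz, rfl⟩ := Submodule.mem_sup.1 h
  obtain ⟨u, rfl⟩ := Ideal.mem_span_singleton'.1 hz
  have hug : homogeneousComponent d (u * g) = coeff 0 u • g := by
    have := DirectSum.coe_decompose_mul_add_of_right_mem (homogeneousSubmodule σ R) (i := 0)
      (a := u) ((mem_homogeneousSubmodule d g).2 hg)
    rwa [zero_add, ← DirectSum.Decomposition.decompose'_eq, decomposition.decompose'_apply,
      decomposition.decompose'_apply, homogeneousComponent_zero, ← smul_eq_C_mul] at this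
  refine ⟨coeff 0 u, ?_⟩
  have hcomp := homogeneousComponent_of_mem (m := d) ((mem_homogeneousSubmodule d _).2 hf)
  rw [if_pos rfl, map_add, hug] at hcomp
  rw [← hcomp, add_sub_cancel_right]
  exact homogeneousComponent_mem_of_mem hI hy d

/-- The shift along a functional `l`, with coefficients reduced modulo `I`. -/
def shiftMod (I : Ideal (MvPolynomial (Fin n) F)) (l : (Fin n → F) →ₗ[F] F) :
    MvPolynomial (Fin n) F →+* Polynomial (MvPolynomial (Fin n) F ⧸ I) :=
  (Polynomial.mapRingHom (Ideal.Quotient.mk I)).comp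
    (shift (Algebra.linearMap F (MvPolynomial (Fin n) F) ∘ₗ l)).toRingHom

lemma shiftMod_linForm (l : (Fin n → F) →ₗ[F] F) (a : Fin n → F) :
    shiftMod I l (linForm a) =
      Polynomial.C (Ideal.Quotient.mk I (C (l a))) * Polynomial.X +
        Polynomial.C (Ideal.Quotient.mk I (linForm a)) := by
  simp [shiftMod, shift_linForm]

lemma coeff_zero_shiftMod (l : (Fin n → F) →ₗ[F] F) (x : MvPolynomial (Fin n) F) :
    (shiftMod I l x).coeff 0 = Ideal.Quotient.mk I x := by
  simp [shiftMod, coeff_zero_shift]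

lemma IsFormIdeal.shiftMod_eq_zero_iff (h : IsFormIdeal K I) {l : (Fin n → F) →ₗ[F] F}
    (hl : K ≤ LinearMap.ker l) {x : MvPolynomial (Fin n) F} : shiftMod I l x = 0 ↔ x ∈ I := by
  refine ⟨fun hx => ?_, fun hx => ?_⟩
  · rw [← Ideal.Quotient.eq_zero_iff_mem, ← coeff_zero_shiftMod l, hx, Polynomial.coeff_zero]
  · have := h.shift_mem_map (hl.trans (LinearMap.ker_le_ker_comp l (Algebra.linearMap F _))) hx
    rwa [← Ideal.mk_ker (I := I), ← Polynomial.ker_mapRingHom] at this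

lemma shiftMod_eq_C_of_mem_closure {l : (Fin n → F) →ₗ[F] F} (hl : K ≤ LinearMap.ker l)
    {p : MvPolynomial (Fin n) F}
    (hp : p ∈ Submonoid.closure (linForm '' (K : Set (Fin n → F)))) :
    shiftMod I l p = Polynomial.C (Ideal.Quotient.mk I p) := by
  simp [shiftMod, shift_eq_C_of_mem_closure (hl.trans (LinearMap.ker_le_ker_comp l _)) hp]

lemma natDegree_shiftMod_prod_le (l : (Fin n → F) →ₗ[F] F) {κ : Type*} (t : Finset κ)
    (a : κ → Fin n → F) : (shiftMod I l (∏ j ∈ t, linForm (a j))).natDegree ≤ #t := by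
  simp only [map_prod, shiftMod_linForm]
  exact natDegree_prod_linear_le t _ _

lemma isUnit_coeff_shiftMod_prod {l : (Fin n → F) →ₗ[F] F} {κ : Type*} {t : Finset κ}
    {a : κ → Fin n → F} (ha : ∀ j ∈ t, l (a j) ≠ 0) :
    IsUnit ((shiftMod I l (∏ j ∈ t, linForm (a j))).coeff #t) := by
  simp only [map_prod, shiftMod_linForm, coeff_card_prod_linear]
  rw [← map_prod, ← map_prod]
  exact ((IsUnit.mk0 _ (Finset.prod_ne_zero_iff.2 ha)).map C).map _

lemma IsFormIdeal.mem_of_linForm_mul_mem (h : IsFormIdeal K I) {a : Fin n → F} (ha : a ∉ K)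
    {x : MvPolynomial (Fin n) F} (hx : linForm a * x ∈ I) : x ∈ I := by
  obtain ⟨l, hl, hla⟩ := exists_functional_eq_one ha
  have hmonic : (shiftMod I l (linForm a)).Monic := by
    rw [shiftMod_linForm, hla, map_one, map_one, map_one, one_mul]
    exact Polynomial.monic_X_add_C _
  rwa [← h.shiftMod_eq_zero_iff hl, map_mul, hmonic.mul_right_eq_zero_iff,
    h.shiftMod_eq_zero_iff hl] at hx

lemma IsFormIdeal.mem_of_prod_linForm_mul_mem (h : IsFormIdeal K I) {κ : Type*} {t : Finset κ}
    {a : κ → Fin n → F} (ha : ∀ j ∈ t, a j ∉ K) {x : MvPolynomial (Fin n) F}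
    (hx : (∏ j ∈ t, linForm (a j)) * x ∈ I) : x ∈ I := by
  classical
  induction t using Finset.induction_on with
  | empty => simpa using hx
  | insert j t hj ih =>
    rw [Finset.prod_insert hj, mul_assoc] at hx
    exact ih (fun i hi => ha i (Finset.mem_insert_of_mem hi))
      (h.mem_of_linForm_mul_mem (ha j (Finset.mem_insert_self j t)) hx)

lemma IsFormIdeal.mem_sup_span_mul (h : IsFormIdeal K I) (hK : K ≤ K')
    {p : MvPolynomial (Fin n) F} (hp : p ∈ Submonoid.closure (linForm '' (K' : Set (Fin n → F))))
    {κ : Type*} {t : Finset κ} {a : κ → Fin n → F} (ha : ∀ j ∈ t, a j ∉ K')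
    {x : MvPolynomial (Fin n) F} (hxp : x ∈ I ⊔ Ideal.span {p})
    (hxt : x ∈ I ⊔ Ideal.span {∏ j ∈ t, linForm (a j)}) :
    x ∈ I ⊔ Ideal.span {p * ∏ j ∈ t, linForm (a j)} := by
  rw [sup_comm, Ideal.mem_span_singleton_sup] at hxt
  obtain ⟨u, y, hy, rfl⟩ := hxt
  have hu : u ∈ I ⊔ Ideal.span {p} := by
    refine (h.sup_span_singleton hK hp).mem_of_prod_linForm_mul_mem ha ?_
    rwa [mul_comm, ← Ideal.add_mem_iff_left _ (Ideal.mem_sup_left hy)]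
  rw [sup_comm, Ideal.mem_span_singleton_sup] at hu
  obtain ⟨v, z, hz, rfl⟩ := hu
  rw [sup_comm, Ideal.mem_span_singleton_sup]
  exact ⟨v, z * ∏ j ∈ t, linForm (a j) + y, I.add_mem (I.mul_mem_right _ hz) hy, by ring⟩

open scoped Classical in
lemma IsFormIdeal.exists_notMem_sup_span_prod (h : IsFormIdeal K I) {κ : Type*} (t : Finset κ)
    {a : κ → Fin n → F} {x : MvPolynomial (Fin n) F}
    (hx : x ∉ I ⊔ Ideal.span {∏ j ∈ t, linForm (a j)}) :
    ∃ i ∈ t, x ∉ I ⊔ Ideal.span {∏ j ∈ t with a j ∈ K ⊔ Submodule.span F {a i}, linForm (a j)} := by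
  induction t using Finset.strongInduction with
  | H t ih =>
  rcases t.eq_empty_or_nonempty with rfl | ⟨i, hi⟩
  · simp at hx
  let K' := K ⊔ Submodule.span F {a i}
  by_contra! hall
  rw [← Finset.prod_filter_mul_prod_filter_not t (fun j => a j ∈ K')] at hx
  refine hx (h.mem_sup_span_mul le_sup_left
    (prod_linForm_mem_closure fun j hj => (Finset.mem_filter.1 hj).2)
    (fun j hj => (Finset.mem_filter.1 hj).2) (hall i hi) ?_)
  by_contra hx'
  have hlt : {j ∈ t | a j ∉ K'} ⊂ t := Finset.filter_ssubset.2
    ⟨i, hi, not_not.2 (Submodule.mem_sup_right (Submodule.mem_span_singleton_self _))⟩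
  obtain ⟨j, hj, hxj⟩ := ih _ hlt hx'
  refine hxj (sup_le_sup_left (Ideal.span_singleton_le_span_singleton.2 ?_) I
    (hall j (hlt.1 hj)))
  exact Finset.prod_dvd_prod_of_subset _ _ _ (Finset.filter_subset_filter _ hlt.1)

lemma IsFormIdeal.exists_sub_smul_prod_mem (h : IsFormIdeal K I) {ι κ : Type*} (t : Finset κ)
    (a : ι → κ → Fin n → F) (b : ι → F) (A : Finset ι)
    (hA : ∑ i ∈ A, b i • ∏ j ∈ t, linForm (a i j) ∉ I) :
    ∃ (K' : Submodule F (Fin n → F)) (I' : Ideal (MvPolynomial (Fin n) F)),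
      IsFormIdeal K' I' ∧ I ≤ I' ∧ Module.finrank F K' + 1 ≤ Module.finrank F K + #A ∧
      ∑ i ∈ A, b i • ∏ j ∈ t, linForm (a i j) ∉ I' ∧
      ∃ i₀ ∈ A, ∃ c : F,
        ∑ i ∈ A, b i • ∏ j ∈ t, linForm (a i j) - c • ∏ j ∈ t, linForm (a i₀ j) ∈ I' := by
  classical
  induction A using Finset.induction_on generalizing K I with
  | empty => simp at hA
  | insert i₀ A hi ih =>
  rw [Finset.card_insert_of_notMem hi]
  by_cases hmem : ∑ i ∈ insert i₀ A, b i • ∏ j ∈ t, linForm (a i j) ∈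
      I ⊔ Ideal.span {∏ j ∈ t, linForm (a i₀ j)}
  · refine ⟨K, I, h, le_rfl, by lia, hA, i₀, Finset.mem_insert_self _ _, ?_⟩
    refine exists_sub_smul_mem_of_mem_sup_span h.isHomogeneous ?_
      (isHomogeneous_prod_linForm t _) hmem
    exact IsHomogeneous.sum _ _ _ fun i _ =>
      Submodule.smul_mem (homogeneousSubmodule _ _ _) _ (isHomogeneous_prod_linForm t _)
  -- Killing the factors of the `i₀`-th product in one line modulo `K` kills that product.
  obtain ⟨j, -, hnot⟩ := h.exists_notMem_sup_span_prod t hmem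
  set K₁ := K ⊔ Submodule.span F {a i₀ j}
  set p := ∏ j ∈ t with a i₀ j ∈ K₁, linForm (a i₀ j)
  have h₁ : IsFormIdeal K₁ (I ⊔ Ideal.span {p}) := h.sup_span_singleton le_sup_left
    (prod_linForm_mem_closure fun j hj => (Finset.mem_filter.1 hj).2)
  have hi₀ : b i₀ • ∏ j ∈ t, linForm (a i₀ j) ∈ I ⊔ Ideal.span {p} :=
    Submodule.smul_of_tower_mem _ _ (Ideal.mem_sup_right (Ideal.mem_span_singleton.2
      (Finset.prod_dvd_prod_of_subset _ _ _ (Finset.filter_subset _ t))))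
  rw [Finset.sum_insert hi, Ideal.add_mem_iff_right _ hi₀] at hnot
  obtain ⟨K', I', h', hI', hrank, hne, i₁, hi₁, c, hc⟩ := ih h₁ hnot
  have hK₁ : Module.finrank F K₁ ≤ Module.finrank F K + 1 := finrank_sup_span_singleton_le K _
  rw [Finset.sum_insert hi]
  refine ⟨K', I', h', le_sup_left.trans hI', by omega, ?_, i₁, Finset.mem_insert_of_mem hi₁, c, ?_⟩
  · rwa [Ideal.add_mem_iff_right _ (hI' hi₀)]
  · rw [add_sub_assoc]
    exact I'.add_mem (hI' hi₀) hc

end FormIdeals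

section Degree

lemma add_natDegree_le_natDegree_mul {R : Type*} [Semiring R] {u P : Polynomial R} {m : ℕ}
    (hu : u ≠ 0) (hdeg : P.natDegree ≤ m) (hP : IsUnit (P.coeff m)) :
    u.natDegree + m ≤ (u * P).natDegree := by
  refine Polynomial.le_natDegree_of_ne_zero ?_
  rw [Polynomial.coeff_mul_add_eq_of_natDegree_le le_rfl hdeg, Ne, hP.mul_left_eq_zero]
  exact Polynomial.leadingCoeff_ne_zero.2 hu

variable {K : Submodule F (Fin n → F)} {I : Ideal (MvPolynomial (Fin n) F)}

lemma IsFormIdeal.card_le_card_of_mul_prod_mem (h : IsFormIdeal K I) {l : (Fin n → F) →ₗ[F] F}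
    (hl : K ≤ LinearMap.ker l) {κ κ' : Type*} {s : Finset κ} {s' : Finset κ'}
    {a : κ → Fin n → F} {a' : κ' → Fin n → F} (ha : ∀ j ∈ s, l (a j) ≠ 0)
    (ha' : ∀ j ∈ s', l (a' j) ≠ 0) {p : MvPolynomial (Fin n) F}
    (hp : p ∈ Submonoid.closure (linForm '' (K : Set (Fin n → F)))) (hpI : p ∉ I)
    (hmem : p * ∏ j ∈ s', linForm (a' j) ∈ I ⊔ Ideal.span {∏ j ∈ s, linForm (a j)}) :
    #s ≤ #s' := by
  obtain ⟨y, hy, z, hz, hyz⟩ := Submodule.mem_sup.1 hmem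
  obtain ⟨u, rfl⟩ := Ideal.mem_span_singleton'.1 hz
  let ψ := shiftMod I l
  have hψp : ψ p = Polynomial.C (Ideal.Quotient.mk I p) := shiftMod_eq_C_of_mem_closure hl hp
  have hψ : ψ p * ψ (∏ j ∈ s', linForm (a' j)) = ψ u * ψ (∏ j ∈ s, linForm (a j)) := by
    rw [← map_mul, ← map_mul, ← hyz, map_add, (h.shiftMod_eq_zero_iff hl).2 hy, zero_add]
  have hu : ψ u ≠ 0 := fun hu => by
    have hcoeff := congrArg (Polynomial.coeff · #s') hψ
    simp only [hψp, hu, zero_mul, Polynomial.coeff_C_mul, Polynomial.coeff_zero] at hcoeff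
    rw [(isUnit_coeff_shiftMod_prod ha').mul_left_eq_zero] at hcoeff
    exact hpI (Ideal.Quotient.eq_zero_iff_mem.1 hcoeff)
  calc #s ≤ (ψ u).natDegree + #s := Nat.le_add_left _ _
    _ ≤ (ψ u * ψ (∏ j ∈ s, linForm (a j))).natDegree :=
      add_natDegree_le_natDegree_mul hu (natDegree_shiftMod_prod_le l s a)
        (isUnit_coeff_shiftMod_prod ha)
    _ = (Polynomial.C (Ideal.Quotient.mk I p) * ψ (∏ j ∈ s', linForm (a' j))).natDegree := by
      rw [← hψ, hψp]
    _ ≤ #s' := (Polynomial.natDegree_C_mul_le _ _).trans (natDegree_shiftMod_prod_le l s' a')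

end Degree

section Matching

variable {K K' : Submodule F (Fin n → F)} {I : Ideal (MvPolynomial (Fin n) F)} {κ : Type*}

open scoped Classical in
lemma prod_filter_notMem_span_mul_prod_filter_lineRep [Fintype κ] {E R : Type*} [AddCommGroup E]
    [Module F E] [CommMonoid R] {v : E} (hv : v ≠ 0) (b : κ → E) (p : κ → R) :
    (∏ j with b j ∉ Submodule.span F {v}, p j) *
      ((∏ j with b j = 0, p j) * ∏ j with lineRep F (b j) = lineRep F v, p j) = ∏ j, p j := by
  let N : Finset κ := {j | b j = 0}
  let S : Finset κ := {j | lineRep F (b j) = lineRep F v}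
  have hunion : N ∪ S = ({j | b j ∈ Submodule.span F {v}} : Finset κ) := by
    ext j
    simp [N, S, mem_span_singleton_iff_lineRep]
  have hdisj : Disjoint N S := Finset.disjoint_filter.2 fun j _ hj hj' =>
    hv (lineRep_eq_zero.1 (hj'.symm.trans (lineRep_eq_zero.2 hj)))
  rw [← Finset.prod_union hdisj, hunion, Finset.prod_filter_not_mul_prod_filter]

open scoped Classical in
lemma IsFormIdeal.card_lineRep_le [Fintype κ] {E : Type*} [AddCommGroup E] [Module F E]
    {q : (Fin n → F) →ₗ[F] E} (h : IsFormIdeal (LinearMap.ker q) I) {a a' : κ → Fin n → F}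
    {f : MvPolynomial (Fin n) F} (hf : f ∉ I) {c c' : F}
    (ha : f - c • ∏ j, linForm (a j) ∈ I) (ha' : f - c' • ∏ j, linForm (a' j) ∈ I)
    {x : E} (hx : x ≠ 0) :
    #{j | lineRep F (q (a j)) = x} ≤ #{j | lineRep F (q (a' j)) = x} := by
  rcases Finset.eq_empty_or_nonempty {j | lineRep F (q (a j)) = x} with hempty | ⟨j₀, hj₀⟩
  · simp [hempty]
  obtain rfl := (Finset.mem_filter.1 hj₀).2
  have hc' : c' ≠ 0 := by
    rintro rfl
    exact hf (by simpa using ha')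
  let v := q (a j₀)
  let S : Finset κ := {j | lineRep F (q (a j)) = lineRep F v}
  let N : Finset κ := {j | q (a' j) = 0}
  let S' : Finset κ := {j | lineRep F (q (a' j)) = lineRep F v}
  let U : Finset κ := {j | q (a' j) ∉ Submodule.span F {v}}
  have hv : v ≠ 0 := mt lineRep_eq_zero.2 hx
  have hsplit : (∏ j ∈ U, linForm (a' j)) *
      ((∏ j ∈ N, linForm (a' j)) * ∏ j ∈ S', linForm (a' j)) = ∏ j, linForm (a' j) :=
    prod_filter_notMem_span_mul_prod_filter_lineRep hv _ _
  have hmem : ∏ j, linForm (a' j) ∈ I ⊔ Ideal.span {∏ j ∈ S, linForm (a j)} := by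
    have hf : f ∈ I ⊔ Ideal.span {∏ j ∈ S, linForm (a j)} := by
      refine (Submodule.sub_mem_iff_left _ ?_).1 (Ideal.mem_sup_left ha)
      refine Submodule.smul_of_tower_mem _ c (Ideal.mem_sup_right (Ideal.mem_span_singleton.2 ?_))
      exact Finset.prod_dvd_prod_of_subset _ _ _ (Finset.subset_univ S)
    refine (((I ⊔ Ideal.span _).restrictScalars F).smul_mem_iff hc').1 ?_
    exact (Submodule.sub_mem_iff_right _ hf).1 (Ideal.mem_sup_left ha')
  have hN : ∏ j ∈ N, linForm (a' j) ∉ I := fun hN => by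
    refine hf ((I.sub_mem_iff_left (Submodule.smul_of_tower_mem I c' ?_)).1 ha')
    exact hsplit ▸ I.mul_mem_left _ (I.mul_mem_right _ hN)
  have h' : IsFormIdeal ((Submodule.span F {v}).comap q)
      (I ⊔ Ideal.span {∏ j ∈ S, linForm (a j)}) := by
    refine h.sup_span_singleton (LinearMap.ker_le_comap q) (prod_linForm_mem_closure fun j hj => ?_)
    exact mem_span_singleton_iff_lineRep.2 (.inr (Finset.mem_filter.1 hj).2)
  obtain ⟨l, -, hlv⟩ := exists_functional_eq_one (mt (Submodule.mem_bot F).1 hv)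
  have hl {b : Fin n → F} (hb : lineRep F (q b) = lineRep F v) : (l ∘ₗ q) b ≠ 0 := by
    obtain ⟨u, hu⟩ := lineRep_eq_lineRep_iff.1 hb
    simp [← hu, Units.smul_def, hlv]
  exact h.card_le_card_of_mul_prod_mem (LinearMap.ker_le_ker_comp q l)
    (fun j hj => hl (Finset.mem_filter.1 hj).2) (fun j hj => hl (Finset.mem_filter.1 hj).2)
    (prod_linForm_mem_closure fun j hj => (Finset.mem_filter.1 hj).2) hN
    (h'.mem_of_prod_linForm_mul_mem (fun j hj => (Finset.mem_filter.1 hj).2) (hsplit ▸ hmem))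

/-- The two families agree modulo `K`, up to the order and nonzero scalars. -/
def Matched (K : Submodule F (Fin n → F)) (a a' : κ → Fin n → F) : Prop :=
  ∃ (σ : Equiv.Perm κ) (u : κ → Fˣ), ∀ j, a' (σ j) - u j • a j ∈ K

lemma Matched.refl (K : Submodule F (Fin n → F)) (a : κ → Fin n → F) : Matched K a a :=
  ⟨1, 1, fun j => by simp⟩

lemma Matched.mono {a a' : κ → Fin n → F} (h : Matched K a a') (hK : K ≤ K') :
    Matched K' a a' := by
  obtain ⟨σ, u, h⟩ := h
  exact ⟨σ, u, fun j => hK (h j)⟩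

lemma Matched.trans {a a' a'' : κ → Fin n → F} (h : Matched K a a') (h' : Matched K a' a'') :
    Matched K a a'' := by
  obtain ⟨σ, u, h⟩ := h
  obtain ⟨σ', u', h'⟩ := h'
  refine ⟨σ.trans σ', fun j => u' (σ j) * u j, fun j => ?_⟩
  have hj := K.add_mem (h' (σ j)) (Submodule.smul_of_tower_mem K (u' (σ j)) (h j))
  rwa [smul_sub, sub_add_sub_cancel, ← mul_smul] at hj

lemma IsFormIdeal.matched [Fintype κ] (h : IsFormIdeal K I) {a a' : κ → Fin n → F}
    {f : MvPolynomial (Fin n) F} (hf : f ∉ I) {c c' : F}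
    (ha : f - c • ∏ j, linForm (a j) ∈ I) (ha' : f - c' • ∏ j, linForm (a' j) ∈ I) :
    Matched K a a' := by
  classical
  rw [← K.ker_mkQ] at h
  obtain ⟨σ, hσ⟩ := exists_perm_of_card_fiber_eq (f := fun j => lineRep F (K.mkQ (a j)))
    (g := fun j => lineRep F (K.mkQ (a' j))) 0 fun x hx =>
      (h.card_lineRep_le hf ha ha' hx).antisymm (h.card_lineRep_le hf ha' ha hx)
  choose u hu using fun j => lineRep_eq_lineRep_iff.1 (hσ j)
  refine ⟨σ, u, fun j => ?_⟩
  rw [← K.ker_mkQ, LinearMap.mem_ker, map_sub, ← hu j, Units.smul_def, Units.smul_def, map_smul,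
    sub_self]

variable [Fintype κ] {ι : Type*} {a : ι → κ → Fin n → F} {b : ι → F}

lemma exists_matched_of_sum_add_sum_eq_zero {A B : Finset ι}
    (hAB : ∑ i ∈ A, b i • ∏ j, linForm (a i j) + ∑ i ∈ B, b i • ∏ j, linForm (a i j) = 0)
    (hA : ∑ i ∈ A, b i • ∏ j, linForm (a i j) ≠ 0) :
    ∃ i ∈ A, ∃ i' ∈ B, ∃ K : Submodule F (Fin n → F),
      Module.finrank F K ≤ #A + #B ∧ Matched K (a i) (a i') := by
  set f := ∑ i ∈ A, b i • ∏ j, linForm (a i j)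
  have hB : ∑ i ∈ B, b i • ∏ j, linForm (a i j) = -f := (neg_eq_of_add_eq_zero_right hAB).symm
  obtain ⟨K₁, I₁, h₁, -, hK₁, hf₁, i, hi, c, hc⟩ :=
    (isFormIdeal_bot ⊥).exists_sub_smul_prod_mem Finset.univ a b A hA
  obtain ⟨K₂, I₂, h₂, hI, hK₂, hf₂, i', hi', c', hc'⟩ :=
    h₁.exists_sub_smul_prod_mem Finset.univ a b B (by rwa [hB, I₁.neg_mem_iff])
  rw [hB] at hf₂ hc'
  rw [finrank_bot] at hK₁
  refine ⟨i, hi, i', hi', K₂, by omega, h₂.matched (mt I₂.neg_mem_iff.2 hf₂) (hI hc) (c' := -c') ?_⟩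
  rw [neg_smul, sub_neg_eq_add, ← neg_mem_iff, neg_add']
  exact hc'

lemma exists_forall_matched [Fintype ι] (hsum : ∑ i, b i • ∏ j, linForm (a i j) = 0)
    (hmin : ∀ A : Finset ι, A.Nonempty → A ≠ Finset.univ →
      ∑ i ∈ A, b i • ∏ j, linForm (a i j) ≠ 0) (i₀ : ι) :
    ∃ K : Submodule F (Fin n → F), Module.finrank F K ≤ Fintype.card ι ^ 2 ∧
      ∀ i, Matched K (a i₀) (a i) := by
  classical
  let P (A : Finset ι) : Prop := i₀ ∈ A ∧ ∃ K : Submodule F (Fin n → F),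
    Module.finrank F K ≤ #A * Fintype.card ι ∧ ∀ i ∈ A, Matched K (a i₀) (a i)
  obtain ⟨A, ⟨hi₀, K, hK, hA⟩, hmax⟩ := (Set.toFinite {A | P A}).exists_maximal
    ⟨{i₀}, Finset.mem_singleton_self i₀, ⊥, by simp, by simp [Matched.refl]⟩
  rcases eq_or_ne A Finset.univ with rfl | hAu
  · exact ⟨K, by rwa [sq], fun i => hA i (Finset.mem_univ i)⟩
  rw [← Finset.sum_add_sum_compl A] at hsum
  obtain ⟨i, hi, i', hi', K', hK', hmatch⟩ :=
    exists_matched_of_sum_add_sum_eq_zero hsum (hmin A ⟨i₀, hi₀⟩ hAu)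
  have hi'A := Finset.mem_compl.1 hi'
  refine absurd (hmax ⟨Finset.mem_insert_of_mem hi₀, K ⊔ K', ?_, ?_⟩
    (Finset.subset_insert i' A) (Finset.mem_insert_self i' A)) hi'A
  · have := Submodule.finrank_add_le_finrank_add_finrank K K'
    rw [Finset.card_add_card_compl] at hK'
    rw [Finset.card_insert_of_notMem hi'A, add_one_mul]
    omega
  · intro e he
    rcases Finset.mem_insert.1 he with rfl | he
    · exact ((hA i hi).mono le_sup_left).trans (hmatch.mono le_sup_right)
    · exact (hA e he).mono le_sup_left

lemma Matched.exists_sub_mem {r a : κ → Fin n → F} (h : Matched K r a) :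
    ∃ (c : F) (a' : κ → Fin n → F), c ≠ 0 ∧ (∀ j, a' j - r j ∈ K) ∧
      ∏ j, linForm (a j) = c • ∏ j, linForm (a' j) ∧
      Submodule.span F (Set.range a) = Submodule.span F (Set.range a') := by
  obtain ⟨σ, u, h⟩ := h
  let a' (j : κ) : Fin n → F := (u j)⁻¹ • a (σ j)
  have ha (j : κ) : a (σ j) = u j • a' j := (smul_inv_smul (u j) _).symm
  refine ⟨∏ j, (u j : F), a', Finset.prod_ne_zero_iff.2 fun j _ => (u j).ne_zero,
    fun j => ?_, ?_, ?_⟩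
  · simpa [a', smul_sub] using Submodule.smul_of_tower_mem K (u j)⁻¹ (h j)
  · rw [← Equiv.prod_comp σ, ← Finset.prod_smul]
    exact Finset.prod_congr rfl fun j _ => by rw [ha, Units.smul_def, linForm_smul]
  · rw [← σ.surjective.range_comp]
    refine le_antisymm (Submodule.span_le.2 ?_) (Submodule.span_le.2 ?_)
    · rintro _ ⟨j, rfl⟩
      rw [Function.comp_apply, ha]
      exact Submodule.smul_of_tower_mem _ _ (Submodule.subset_span (Set.mem_range_self j))
    · rintro _ ⟨j, rfl⟩
      exact Submodule.smul_of_tower_mem _ _ (Submodule.subset_span (Set.mem_range_self j))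

end Matching

section InnerParts

variable {κ ι : Type*} {K L : Submodule F (Fin n → F)} {r : κ → Fin n → F}

open scoped Classical in
/-- The part of the product `∏ j, linForm (a j)` formed by the factors whose reference form
`r j` lies in `K`. All families `a` considered are congruent to `r` modulo `K`. -/
def innerPart [Fintype κ] (K : Submodule F (Fin n → F)) (r a : κ → Fin n → F) :
    MvPolynomial (Fin n) F :=
  ∏ j with r j ∈ K, linForm (a j)

open scoped Classical in
lemma IsFormIdeal.sum_filter_mem {I : Ideal (MvPolynomial (Fin n) F)} (hI : IsFormIdeal K I)
    {A : Finset ι} {t : Finset κ} {a : ι → κ → Fin n → F} (ha : ∀ i ∈ A, ∀ j, a i j - r j ∈ K)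
    {β : ι → F} (h : ∑ i ∈ A, β i • ∏ j ∈ t, linForm (a i j) ∈ I) :
    ∑ i ∈ A, β i • ∏ j ∈ t with r j ∈ K, linForm (a i j) ∈ I := by
  obtain ⟨q, hq, rfl⟩ := exists_idempotent_ker_eq K
  have hqr (i) (hi : i ∈ A) (j) : q (a i j) = q (r j) := by
    simpa [sub_eq_zero] using ha i hi j
  let w := linFormₗ ∘ₗ q
  have hw (x : Fin n → F) : w x = linForm (q x) := rfl
  have hcoeff (i) (hi : i ∈ A) :
      (shift w (∏ j ∈ t, linForm (a i j))).coeff #{j ∈ t | r j ∉ LinearMap.ker q} =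
        (∏ j ∈ t with r j ∉ LinearMap.ker q, linForm (q (r j))) *
          ∏ j ∈ t with r j ∈ LinearMap.ker q, linForm (a i j) := by
    have := coeff_shift_prod_linForm w t (a i)
    simp only [hw, hqr i hi, linForm_eq_zero, ne_eq] at this
    simpa only [LinearMap.mem_ker, mul_comm] using this
  have hmem := Ideal.mem_map_C_iff.1 (hI.shift_mem_map (w := w) (LinearMap.ker_le_ker_comp q _) h)
    #{j ∈ t | r j ∉ LinearMap.ker q}
  rw [map_sum, Polynomial.finsetSum_coeff, Finset.sum_congr rfl fun i hi => by
    rw [map_smul, Polynomial.coeff_smul, hcoeff i hi, ← mul_smul_comm], ← Finset.mul_sum] at hmem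
  refine hI.mem_of_prod_linForm_mul_mem (fun j hj => ?_) hmem
  have hqq : q (q (r j)) = q (r j) := DFunLike.congr_fun hq (r j)
  simpa [hqq] using (Finset.mem_filter.1 hj).2

variable [Fintype κ]

lemma IsFormIdeal.sum_innerPart_mem {I : Ideal (MvPolynomial (Fin n) F)} (hI : IsFormIdeal K I)
    {A : Finset ι} {a : ι → κ → Fin n → F} (ha : ∀ i ∈ A, ∀ j, a i j - r j ∈ K) {β : ι → F}
    (h : ∑ i ∈ A, β i • ∏ j, linForm (a i j) ∈ I) : ∑ i ∈ A, β i • innerPart K r (a i) ∈ I :=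
  hI.sum_filter_mem ha h

lemma sum_innerPart_eq_zero_of_le (hKL : K ≤ L) {A : Finset ι} {a : ι → κ → Fin n → F}
    (ha : ∀ i ∈ A, ∀ j, a i j - r j ∈ K) {β : ι → F}
    (h : ∑ i ∈ A, β i • innerPart L r (a i) = 0) : ∑ i ∈ A, β i • innerPart K r (a i) = 0 := by
  classical
  have := (isFormIdeal_bot K).sum_filter_mem ha (Ideal.mem_bot.2 h)
  simpa only [Finset.filter_filter, and_iff_right_of_imp (@hKL _), Ideal.mem_bot,
    innerPart] using this

lemma innerPart_dvd (K : Submodule F (Fin n → F)) (r a : κ → Fin n → F) :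
    innerPart K r a ∣ ∏ j, linForm (a j) :=
  by classical exact Finset.prod_dvd_prod_of_subset _ _ _ (Finset.filter_subset _ _)

lemma exists_sum_innerPart_ne_zero (K : Submodule F (Fin n → F)) {A : Finset ι}
    {a : ι → κ → Fin n → F} (ha : ∀ i ∈ A, ∀ j, a i j - r j ∈ K) {β : ι → F}
    (hβ : ∑ i ∈ A, β i • ∏ j, linForm (a i j) ≠ 0) :
    ∃ K', K ≤ K' ∧ Module.finrank F K' ≤ Module.finrank F K + #A ∧
      ∑ i ∈ A, β i • innerPart K' r (a i) ≠ 0 := by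
  classical
  obtain ⟨K₁, I, hI, -, hK₁, hsum, i₀, hi₀, c, hc⟩ :=
    (isFormIdeal_bot ⊥).exists_sub_smul_prod_mem Finset.univ a β A (mt Ideal.mem_bot.1 hβ)
  rw [finrank_bot] at hK₁
  have hrank := Submodule.finrank_add_le_finrank_add_finrank K K₁
  refine ⟨K ⊔ K₁, le_sup_left, by omega, fun h0 => hsum ?_⟩
  have split (p : ι → MvPolynomial (Fin n) F) :
      ∑ i ∈ A, (β - Pi.single i₀ c : ι → F) i • p i = ∑ i ∈ A, β i • p i - c • p i₀ := by
    simp [sub_smul, Pi.single_apply, ite_smul, hi₀]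
  have hinner := (hI.mono le_sup_right).sum_innerPart_mem (β := β - Pi.single i₀ c)
    (fun i hi j => (le_sup_left : K ≤ K ⊔ K₁) (ha i hi j)) (by rwa [split])
  rw [split, h0, zero_sub, I.neg_mem_iff] at hinner
  refine (Submodule.sub_mem_iff_left I ?_).1 hc
  obtain ⟨y, hy⟩ := innerPart_dvd (K ⊔ K₁) r (a i₀)
  rw [hy, ← smul_mul_assoc]
  exact I.mul_mem_right _ hinner

/-- Each step of the descent adds at most `card ι` dimensions to `K` and kills a relation. -/
lemma exists_linearIndependent_innerPart [Fintype ι] (K : Submodule F (Fin n → F))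
    {a : ι → κ → Fin n → F} (ha : ∀ i j, a i j - r j ∈ K)
    (hind : LinearIndependent F fun i => ∏ j, linForm (a i j)) :
    ∃ K', K ≤ K' ∧ Module.finrank F K' ≤ Module.finrank F K + Fintype.card ι ^ 2 ∧
      LinearIndependent F fun i => innerPart K' r (a i) := by
  let V (K' : Submodule F (Fin n → F)) : Submodule F (ι → F) :=
    LinearMap.ker (Fintype.linearCombination F fun i => innerPart K' r (a i))
  have mem_V {K' β} : β ∈ V K' ↔ ∑ i, β i • innerPart K' r (a i) = 0 := by
    simp [V, Fintype.linearCombination_apply]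
  let P (K' : Submodule F (Fin n → F)) : Prop := K ≤ K' ∧ Module.finrank F K' +
    Module.finrank F (V K') * Fintype.card ι ≤ Module.finrank F K + Fintype.card ι ^ 2
  have hPK : P K := by
    have := Submodule.finrank_le (V K)
    rw [Module.finrank_fintype_fun_eq_card] at this
    exact ⟨le_rfl, by rw [sq]; gcongr⟩
  obtain ⟨K', ⟨hKK', hK'⟩, hmin⟩ :=
    exists_minimalFor_of_wellFoundedLT P (fun K' => Module.finrank F (V K')) ⟨K, hPK⟩
  refine ⟨K', hKK', by omega, Fintype.linearIndependent_iff.2 fun β hβ => ?_⟩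
  by_contra! hβ0
  have hne : ∑ i, β i • ∏ j, linForm (a i j) ≠ 0 := fun h =>
    hβ0.elim fun i hi => hi (Fintype.linearIndependent_iff.1 hind β h i)
  obtain ⟨K'', hK'', hrank, hβ''⟩ :=
    exists_sum_innerPart_ne_zero K' (fun i _ j => hKK' (ha i j)) hne
  have hlt : V K'' < V K' := lt_of_le_of_ne
    (fun γ hγ => mem_V.2 (sum_innerPart_eq_zero_of_le hK'' (fun i _ j => hKK' (ha i j))
      (mem_V.1 hγ)))
    fun h => hβ'' (mem_V.1 (h ▸ mem_V.2 hβ))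
  have hfin := Submodule.finrank_lt_finrank_of_lt hlt
  refine hfin.not_ge (hmin ⟨hKK'.trans hK'', ?_⟩ hfin.le)
  have := Nat.mul_le_mul_right (Fintype.card ι) hfin
  rw [Nat.succ_mul] at this
  rw [Finset.card_univ] at hrank
  omega

end InnerParts

section Directions

variable {κ ι E : Type*} [Fintype κ] [AddCommGroup E] [Module F E] {q : (Fin n → F) →ₗ[F] E}
  {r : κ → Fin n → F}

open scoped Classical in
/-- The part of the product `∏ j, linForm (a j)` formed by the factors whose reference form `r j`
has the direction `v` modulo `ker q`, with directions normalized by `lineRep`. -/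
def directionPart (q : (Fin n → F) →ₗ[F] E) (r a : κ → Fin n → F) (v : E) :
    MvPolynomial (Fin n) F :=
  ∏ j with lineRep F (q (r j)) = v, linForm (a j)

open scoped Classical in
/-- The nonzero directions, among those of the reference family, in which the products
`∏ j, linForm (a i j)`, `i ∈ A`, do not all have the same part. -/
def varyingDirections (q : (Fin n → F) →ₗ[F] E) (r : κ → Fin n → F) (a : ι → κ → Fin n → F)
    (A : Finset ι) : Finset E :=
  {v ∈ Finset.univ.image fun j => lineRep F (q (r j)) |
    v ≠ 0 ∧ ∃ i ∈ A, ∃ i' ∈ A, directionPart q r (a i) v ≠ directionPart q r (a i') v}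

lemma mem_varyingDirections {a : ι → κ → Fin n → F} {A : Finset ι} {v : E} :
    v ∈ varyingDirections q r a A ↔ (∃ j, lineRep F (q (r j)) = v) ∧ v ≠ 0 ∧
      ∃ i ∈ A, ∃ i' ∈ A, directionPart q r (a i) v ≠ directionPart q r (a i') v := by
  simp [varyingDirections]

lemma card_varyingDirections_le (q : (Fin n → F) →ₗ[F] E) (r : κ → Fin n → F)
    (a : ι → κ → Fin n → F) (A : Finset ι) : #(varyingDirections q r a A) ≤ Fintype.card κ := by
  classical
  exact (Finset.card_filter_le _ _).trans Finset.card_image_le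

lemma directionPart_ne_zero {a : κ → Fin n → F} (ha : ∀ j, a j ≠ 0) (v : E) :
    directionPart q r a v ≠ 0 :=
  prod_linForm_ne_zero fun j _ => ha j

lemma directionPart_zero (q : (Fin n → F) →ₗ[F] E) (r a : κ → Fin n → F) :
    directionPart q r a 0 = innerPart (LinearMap.ker q) r a :=
  Finset.prod_congr (by ext j; simp [lineRep_eq_zero]) fun _ _ => rfl

lemma innerPart_comap_eq_prod {U : Submodule F E} {D : Finset E}
    (hD : ∀ j, q (r j) ∈ U ↔ lineRep F (q (r j)) ∈ D) (a : κ → Fin n → F) :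
    innerPart (U.comap q) r a = ∏ v ∈ D, directionPart q r a v := by
  classical
  simp only [innerPart, Submodule.mem_comap, hD]
  rw [← Finset.prod_fiberwise_of_maps_to (t := D) (g := fun j => lineRep F (q (r j)))
    (fun j hj => (Finset.mem_filter.1 hj).2)]
  refine Finset.prod_congr rfl fun v hv => ?_
  rw [directionPart, Finset.filter_filter]
  exact Finset.prod_congr
    (Finset.filter_congr fun j _ => and_iff_right_of_imp (· ▸ hv)) fun _ _ => rfl

lemma exists_innerPart_comap_span_eq_mul {a : ι → κ → Fin n → F} {A : Finset ι}
    (ha : ∀ i ∈ A, ∀ j, a i j ≠ 0) {B : Finset E} (hB : B ⊆ varyingDirections q r a A)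
    (hspan : ∀ v ∈ varyingDirections q r a A, v ∈ Submodule.span F (B : Set E) → v ∈ B) :
    ∃ p ≠ 0, ∀ i ∈ A, innerPart ((Submodule.span F (B : Set E)).comap q) r (a i) =
      p * (innerPart (LinearMap.ker q) r (a i) * ∏ v ∈ B, directionPart q r (a i) v) := by
  classical
  rcases A.eq_empty_or_nonempty with rfl | ⟨i₀, hi₀⟩
  · exact ⟨1, one_ne_zero, by simp⟩
  let Z : Finset E := {v ∈ Finset.univ.image fun j => lineRep F (q (r j)) |
    v ∈ Submodule.span F (B : Set E) ∧ v ∉ insert 0 B}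
  have hZ {v : E} (hv : v ∈ Z) {i : ι} (hi : i ∈ A) :
      directionPart q r (a i) v = directionPart q r (a i₀) v := by
    simp only [Z, Finset.mem_filter, Finset.mem_image, Finset.mem_insert, not_or] at hv
    obtain ⟨⟨j, -, hj⟩, hvB, hv0, hv⟩ := hv
    by_contra hne
    exact hv (hspan v (mem_varyingDirections.2 ⟨⟨j, hj⟩, hv0, i, hi, i₀, hi₀, hne⟩) hvB)
  have hdir (j : κ) : q (r j) ∈ Submodule.span F (B : Set E) ↔
      lineRep F (q (r j)) ∈ Z ∪ insert 0 B := by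
    rw [← lineRep_mem_iff]
    refine ⟨fun hj => ?_, fun hj => ?_⟩
    · by_cases hjB : lineRep F (q (r j)) ∈ insert 0 B
      · exact Finset.mem_union_right _ hjB
      · exact Finset.mem_union_left _ (Finset.mem_filter.2 ⟨by simp, hj, hjB⟩)
    · rcases Finset.mem_union.1 hj with hj | hj
      · exact (Finset.mem_filter.1 hj).2.1
      · rcases Finset.mem_insert.1 hj with hj | hj
        · simp [hj]
        · exact Submodule.subset_span hj
  have h0 : (0 : E) ∉ B := fun h => (mem_varyingDirections.1 (hB h)).2.1 rfl
  refine ⟨∏ v ∈ Z, directionPart q r (a i₀) v,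
    Finset.prod_ne_zero_iff.2 fun v _ => directionPart_ne_zero (ha i₀ hi₀) v, fun i hi => ?_⟩
  rw [innerPart_comap_eq_prod hdir, Finset.prod_union (Finset.disjoint_left.2 fun v hv =>
    (Finset.mem_filter.1 hv).2.2), Finset.prod_insert h0, directionPart_zero,
    Finset.prod_congr rfl fun v hv => hZ hv hi]

end Directions

section SylvesterGallai

variable {κ ι : Type*} [Fintype κ] {N : ℕ} {q : (Fin n → F) →ₗ[F] (Fin N → F)}
  {r : κ → Fin n → F} {a : ι → κ → Fin n → F} {A : Finset ι} {β : ι → F}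

lemma sum_smul_innerPart_mul_prod_directionPart_eq_zero (ha : ∀ i ∈ A, ∀ j, a i j ≠ 0)
    (har : ∀ i ∈ A, ∀ j, a i j - r j ∈ LinearMap.ker q)
    (hsum : ∑ i ∈ A, β i • ∏ j, linForm (a i j) = 0) {B : Finset (Fin N → F)}
    (hB : B ⊆ varyingDirections q r a A)
    (hspan : ∀ v ∈ varyingDirections q r a A,
      v ∈ Submodule.span F (B : Set (Fin N → F)) → v ∈ B) :
    ∑ i ∈ A, β i • innerPart (LinearMap.ker q) r (a i) *
      ∏ v ∈ B, directionPart q r (a i) v = 0 := by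
  obtain ⟨p, hp, hinner⟩ := exists_innerPart_comap_span_eq_mul ha hB hspan
  have := (isFormIdeal_bot ((Submodule.span F (B : Set (Fin N → F))).comap q)).sum_innerPart_mem
    (fun i hi j => LinearMap.ker_le_comap q (har i hi j)) (Ideal.mem_bot.2 hsum)
  rw [Finset.sum_congr rfl fun i hi => by rw [hinner i hi, ← mul_smul_comm, ← smul_mul_assoc],
    ← Finset.mul_sum, Ideal.mem_bot] at this
  exact (mul_eq_zero.1 this).resolve_left hp

lemma sgClosed_varyingDirections {m : ℕ} (hA : A.Nonempty) (hcard : #A ≤ m + 1)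
    (ha : ∀ i ∈ A, ∀ j, a i j ≠ 0) (har : ∀ i ∈ A, ∀ j, a i j - r j ∈ LinearMap.ker q)
    (hβ : ∀ i ∈ A, β i ≠ 0) (hsum : ∑ i ∈ A, β i • ∏ j, linForm (a i j) = 0)
    (hmin : ∀ B ⊂ A, B.Nonempty → ∑ i ∈ B, β i • innerPart (LinearMap.ker q) r (a i) ≠ 0) :
    SGClosed m (varyingDirections q r a A) := by
  refine ⟨fun v hv => (mem_varyingDirections.1 hv).2.1, fun u hu v hv huv c h => ?_,
    fun V hVS hVm hV => ?_⟩
  · obtain ⟨⟨j, rfl⟩, hu0, -⟩ := mem_varyingDirections.1 hu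
    obtain ⟨⟨j', rfl⟩, -⟩ := mem_varyingDirections.1 hv
    exact huv (lineRep_eq_of_eq_smul hu0 h)
  by_contra! hlt
  have hVspan : (V : Set (Fin N → F)) = {v | v ∈ varyingDirections q r a A ∧
      v ∈ Submodule.span F (V : Set (Fin N → F))} :=
    Set.eq_of_subset_of_ncard_le (fun v hv => ⟨hVS hv, Submodule.subset_span hv⟩)
      (by rw [Set.ncard_coe_finset]; omega)
      ((varyingDirections q r a A).finite_toSet.subset fun v hv => hv.1)
  have hspan {B : Finset (Fin N → F)} (hB : B ⊆ V) (v) (hv : v ∈ varyingDirections q r a A)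
      (hvB : v ∈ Submodule.span F (B : Set (Fin N → F))) : v ∈ B := by
    have hvV : v ∈ (V : Set (Fin N → F)) := hVspan ▸ ⟨hv, Submodule.span_mono hB hvB⟩
    exact (LinearIndepOn.mem_span_iff_id (LinearIndepOn.mono hV hB)).1 hvB
      (LinearIndepOn.mono hV (Set.insert_subset hvV hB))
  obtain ⟨i, hi⟩ := hA
  have hx : β i • innerPart (LinearMap.ker q) r (a i) ≠ 0 :=
    smul_ne_zero (hβ i hi) (prod_linForm_ne_zero fun j _ => ha i hi j)
  obtain ⟨B, hBA, hB, hsumB⟩ := exists_ssubset_sum_eq_zero_of_orthogonal ⟨i, hi, hx⟩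
    (U := V) (θ := fun v i => directionPart q r (a i) v)
    (fun v hv => (mem_varyingDirections.1 (hVS hv)).2.2) (by omega)
    fun B hB => sum_smul_innerPart_mul_prod_directionPart_eq_zero ha har hsum (hB.trans hVS)
      (hspan hB)
  exact hmin B hBA hB hsumB

lemma SGClosed.finrank_le_SG {m d : ℕ} {S : Finset (Fin N → F)} (h : SGClosed m S)
    (hd : #S ≤ d) :
    Module.finrank F (Submodule.span F (S : Set (Fin N → F))) ≤ SG F m d := by
  refine le_csSup ⟨d, ?_⟩ ⟨N, S, hd, h, rfl⟩
  rintro _ ⟨N', S', hS', -, rfl⟩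
  exact (finrank_span_finset_le_card S').trans hS'

end SylvesterGallai

section Rank

variable {k d : ℕ} {C : Circuit F n k d} {K : Submodule F (Fin n → F)} {I : Finset (Fin k)}

namespace Circuit

lemma term_eq_smul (C : Circuit F n k d) (i : Fin k) :
    C.term i = C.coeff i • ∏ j, linForm (C.form i j) := by
  rw [term, smul_eq_C_mul]

lemma term_ne_zero (C : Circuit F n k d) (i : Fin k) : C.term i ≠ 0 := by
  rw [term_eq_smul]
  exact smul_ne_zero (C.coeff_ne_zero i) (prod_linForm_ne_zero fun j _ => C.form_ne_zero i j)

lemma indFanin_le (C : Circuit F n k d) : C.indFanin ≤ k :=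
  Finset.sup_le fun I _ => by simpa using Finset.card_le_univ I

lemma exists_maximal_linearIndepOn_term (C : Circuit F n k d) :
    ∃ I : Finset (Fin k), #I = C.indFanin ∧ LinearIndepOn F C.term (I : Set (Fin k)) ∧
      ∀ j ∉ I, C.term j ∈ Submodule.span F (C.term '' I) := by
  classical
  have mem_iff (I : Finset (Fin k)) :
      (I ∈ Finset.univ.filter fun I : Finset (Fin k) =>
        LinearIndependent F fun i : I => C.term i) ↔ LinearIndepOn F C.term (I : Set (Fin k)) :=
    Finset.mem_filter.trans (and_iff_right (Finset.mem_univ I))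
  obtain ⟨I, hI, hcard⟩ := Finset.exists_mem_eq_sup _ ⟨∅, (mem_iff ∅).2 (by simp)⟩ Finset.card
  refine ⟨I, hcard.symm, (mem_iff I).1 hI, fun j hj => ?_⟩
  by_contra hspan
  have hle := Finset.le_sup (f := Finset.card) ((mem_iff (insert j I)).2 (by
    rw [Finset.coe_insert]
    exact ((mem_iff I).1 hI).insert hspan))
  rw [hcard, Finset.card_insert_of_notMem hj] at hle
  omega

/-- A rewriting of the multiplication terms of `C` in which the `j`-th forms of all the terms are
congruent modulo `K` to a common reference form `ref j`. -/
structure Alignment (C : Circuit F n k d) (K : Submodule F (Fin n → F)) where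
  ref : Fin d → Fin n → F
  form : Fin k → Fin d → Fin n → F
  coeff : Fin k → F
  sub_mem : ∀ i j, form i j - ref j ∈ K
  term_eq : ∀ i, C.term i = coeff i • ∏ j, linForm (form i j)
  span_eq : ∀ i, Submodule.span F (Set.range (C.form i)) = Submodule.span F (Set.range (form i))

namespace Alignment

/-- The same rewriting, viewed modulo a larger subspace. -/
def mono (P : C.Alignment K) {L : Submodule F (Fin n → F)} (h : K ≤ L) : C.Alignment L :=
  { P with sub_mem := fun i j => h (P.sub_mem i j) }

/-- The part of the `i`-th term formed by its coefficient and the factors congruent to reference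
forms in `K`. -/
def innerTerm (P : C.Alignment K) (i : Fin k) : MvPolynomial (Fin n) F :=
  P.coeff i • innerPart K P.ref (P.form i)

lemma coeff_ne_zero (P : C.Alignment K) (i : Fin k) : P.coeff i ≠ 0 :=
  left_ne_zero_of_smul (P.term_eq i ▸ C.term_ne_zero i)

lemma form_ne_zero (P : C.Alignment K) (i : Fin k) (j : Fin d) : P.form i j ≠ 0 := fun h =>
  right_ne_zero_of_smul (P.term_eq i ▸ C.term_ne_zero i)
    (Finset.prod_eq_zero (Finset.mem_univ j) (linForm_eq_zero.2 h))

lemma isFundamentalRelation_innerTerm (P : C.Alignment K) {j : Fin k} {γ : Fin k →₀ F}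
    (h : IsFundamentalRelation C.term I j γ) : IsFundamentalRelation P.innerTerm I j γ where
  mem_support := h.mem_support
  support_subset := h.support_subset
  linearCombination_eq_zero := by
    have := (isFormIdeal_bot K).sum_innerPart_mem (β := fun i => γ i * P.coeff i)
      (fun i (_ : i ∈ γ.support) j => P.sub_mem i j) <| Ideal.mem_bot.2 <| by
        simpa only [P.term_eq, smul_smul] using h.sum_eq_zero
    simpa only [Finsupp.linearCombination_apply, Finsupp.sum, innerTerm, smul_smul, Ideal.mem_bot]
      using this

variable {N : ℕ} {q : (Fin n → F) →ₗ[F] (Fin N → F)}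

lemma map_form (P : C.Alignment (LinearMap.ker q)) (i : Fin k) (j : Fin d) :
    q (P.form i j) = q (P.ref j) :=
  LinearMap.sub_mem_ker_iff.1 (P.sub_mem i j)

lemma sgClosed_varyingDirections (P : C.Alignment (LinearMap.ker q))
    (hI : LinearIndepOn F P.innerTerm (I : Set (Fin k))) {m : ℕ} (hm : #I ≤ m) {j : Fin k}
    {γ : Fin k →₀ F} (hγ : IsFundamentalRelation C.term I j γ) :
    SGClosed m (varyingDirections q P.ref P.form γ.support) := by
  classical
  have hcard : #γ.support ≤ m + 1 :=
    calc #γ.support ≤ #(insert j I) := Finset.card_le_card (by exact_mod_cast hγ.support_subset)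
      _ ≤ #I + 1 := Finset.card_insert_le j I
      _ ≤ m + 1 := by gcongr
  refine DepthThree.sgClosed_varyingDirections (β := fun i => γ i * P.coeff i)
    ⟨j, hγ.mem_support⟩ hcard (fun i _ => P.form_ne_zero i) (fun i _ => P.sub_mem i)
    (fun i hi => mul_ne_zero (Finsupp.mem_support_iff.1 hi) (P.coeff_ne_zero i)) ?_
    fun B hB hne => ?_
  · simpa only [P.term_eq, smul_smul] using hγ.sum_eq_zero
  · simpa only [innerTerm, smul_smul] using
      (P.isFundamentalRelation_innerTerm hγ).sum_ne_zero hI hB hne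

/-- If no fundamental relation varies in the direction of a form, then all the terms have the same
part in this direction, so that the form divides them all. -/
lemma exists_mem_varyingDirections (P : C.Alignment (LinearMap.ker q)) (hid : C.IsIdentity)
    (hsimple : C.IsSimple) (hmin : C.IsMinimal) (hI : LinearIndepOn F C.term (I : Set (Fin k)))
    {Γ : Fin k → Fin k →₀ F} (hΓ : ∀ j ∉ I, IsFundamentalRelation C.term I j (Γ j)) {i : Fin k}
    {e : Fin d} (he : q (P.form i e) ≠ 0) :
    ∃ j ∉ I, lineRep F (q (P.form i e)) ∈ varyingDirections q P.ref P.form (Γ j).support := by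
  classical
  by_contra! hno
  set v := lineRep F (q (P.form i e)) with hv
  rw [P.map_form] at hv
  have hconst : ∀ i', directionPart q P.ref (P.form i) v = directionPart q P.ref (P.form i') v :=
    eq_of_forall_isFundamentalRelation hI hid hmin hΓ (fun j hj i' hi' => by
      by_contra hne
      exact hno j hj (mem_varyingDirections.2 ⟨⟨e, hv.symm⟩, mt lineRep_eq_zero.1 he, i', hi', j,
        (hΓ j hj).mem_support, hne⟩)) i
  refine hsimple ⟨P.form i e, P.form_ne_zero i e, fun i' => ?_⟩
  calc linForm (P.form i e) ∣ directionPart q P.ref (P.form i) v :=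
        Finset.dvd_prod_of_mem _ (by simp [hv])
    _ = directionPart q P.ref (P.form i') v := hconst i'
    _ ∣ ∏ j, linForm (P.form i' j) := Finset.prod_dvd_prod_of_subset _ _ _ (Finset.subset_univ _)
    _ ∣ C.term i' := P.term_eq i' ▸ Dvd.intro_left _ (smul_eq_C_mul _ _).symm

lemma form_mem_comap_sup_span_varyingDirections (P : C.Alignment (LinearMap.ker q))
    (hid : C.IsIdentity) (hsimple : C.IsSimple) (hmin : C.IsMinimal)
    (hI : LinearIndepOn F C.term (I : Set (Fin k))) {Γ : Fin k → Fin k →₀ F}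
    (hΓ : ∀ j ∉ I, IsFundamentalRelation C.term I j (Γ j)) (i : Fin k) (e : Fin d) :
    P.form i e ∈ (Iᶜ.sup fun j => Submodule.span F
      (varyingDirections q P.ref P.form (Γ j).support : Set (Fin N → F))).comap q := by
  rcases eq_or_ne (q (P.form i e)) 0 with h0 | h0
  · simp [h0]
  obtain ⟨j, hj, hv⟩ := P.exists_mem_varyingDirections hid hsimple hmin hI hΓ h0
  refine Finset.le_sup (f := fun j => Submodule.span F
    (varyingDirections q P.ref P.form (Γ j).support : Set (Fin N → F))) (Finset.mem_compl.2 hj) ?_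
  exact lineRep_mem_iff.1 (Submodule.subset_span hv)

lemma rank_le (P : C.Alignment K) {W : Submodule F (Fin n → F)} (hW : ∀ i j, P.form i j ∈ W) :
    C.rank ≤ Module.finrank F W := by
  refine Submodule.finrank_mono (Submodule.span_le.2 ?_)
  rintro _ ⟨i, j, rfl⟩
  have hspan : Submodule.span F (Set.range (C.form i)) ≤ W := by
    rw [P.span_eq, Submodule.span_le]
    exact Set.range_subset_iff.2 (hW i)
  exact hspan (Submodule.subset_span ⟨j, rfl⟩)

end Alignment

lemma exists_alignment (hid : C.IsIdentity) (hmin : C.IsMinimal) :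
    ∃ K : Submodule F (Fin n → F), Module.finrank F K ≤ k ^ 2 ∧ Nonempty (C.Alignment K) := by
  rcases isEmpty_or_nonempty (Fin k) with _ | ⟨⟨i₀⟩⟩
  · exact ⟨⊥, by simp, ⟨⟨0, isEmptyElim, isEmptyElim, isEmptyElim, isEmptyElim, isEmptyElim⟩⟩⟩
  obtain ⟨K, hK, hmatch⟩ := exists_forall_matched (b := C.coeff) (a := C.form)
    (by simpa only [IsIdentity, term_eq_smul] using hid)
    (by simpa only [IsMinimal, term_eq_smul] using hmin) i₀
  choose c form _ sub_mem prod_eq span_eq using fun i => (hmatch i).exists_sub_mem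
  exact ⟨K, by simpa using hK, ⟨⟨C.form i₀, form, fun i => C.coeff i * c i, sub_mem,
    fun i => by rw [term_eq_smul, prod_eq, smul_smul], span_eq⟩⟩⟩

lemma exists_alignment_linearIndepOn_innerTerm (hid : C.IsIdentity) (hmin : C.IsMinimal)
    (hI : LinearIndepOn F C.term (I : Set (Fin k))) :
    ∃ (K : Submodule F (Fin n → F)) (P : C.Alignment K), Module.finrank F K ≤ 2 * k ^ 2 ∧
      LinearIndepOn F P.innerTerm (I : Set (Fin k)) := by
  obtain ⟨K, hK, ⟨P⟩⟩ := C.exists_alignment hid hmin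
  let u (i : I) : Fˣ := Units.mk0 (P.coeff i) (P.coeff_ne_zero i)
  have hterm : (u • fun i : I => ∏ j, linForm (P.form i j)) = fun i : I => C.term i := by
    ext1 i
    exact (P.term_eq i).symm
  have hprod : LinearIndependent F fun i : I => ∏ j, linForm (P.form i j) :=
    (LinearIndependent.units_smul_iff _ u).1 (hterm ▸ hI)
  obtain ⟨L, hKL, hL, hinner⟩ :=
    exists_linearIndependent_innerPart K (fun (i : I) j => P.sub_mem i j) hprod
  have hcard : #I ^ 2 ≤ k ^ 2 := Nat.pow_le_pow_left (by simpa using Finset.card_le_univ I) 2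
  rw [Fintype.card_coe] at hL
  exact ⟨L, P.mono hKL, by omega, hinner.units_smul u⟩

end Circuit

end Rank

end

end DepthThree

open DepthThree in
theorem mainTheorem2_general {F : Type*} [Field F] {n k d m : ℕ} (C : Circuit F n k d)
    (hid : C.IsIdentity) (hsimple : C.IsSimple) (hmin : C.IsMinimal) (hm : C.indFanin ≤ m) :
    C.rank ≤ 2 * k ^ 2 + (k - C.indFanin) * SG F m d := by
  obtain ⟨I, hIcard, hI, hspan⟩ := C.exists_maximal_linearIndepOn_term
  choose! Γ hΓ using fun j (hj : j ∉ I) => exists_isFundamentalRelation hj (hspan j hj)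
  obtain ⟨K, P, hK, hinner⟩ := C.exists_alignment_linearIndepOn_innerTerm hid hmin hI
  obtain ⟨q, -, rfl⟩ := exists_idempotent_ker_eq K
  let W (j : Fin k) : Submodule F (Fin n → F) :=
    Submodule.span F (varyingDirections q P.ref P.form (Γ j).support)
  have hW (j : Fin k) (hj : j ∈ Iᶜ) : Module.finrank F (W j) ≤ SG F m d :=
    (P.sgClosed_varyingDirections hinner (hIcard.trans_le hm)
      (hΓ j (Finset.mem_compl.1 hj))).finrank_le_SG
        ((card_varyingDirections_le ..).trans_eq (Fintype.card_fin d))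
  calc C.rank
      ≤ Module.finrank F ((Iᶜ.sup W).comap q) :=
        P.rank_le (P.form_mem_comap_sup_span_varyingDirections hid hsimple hmin hI hΓ)
    _ ≤ Module.finrank F (Iᶜ.sup W : Submodule F (Fin n → F)) +
          Module.finrank F (LinearMap.ker q) := finrank_comap_le q _
    _ ≤ ∑ j ∈ Iᶜ, Module.finrank F (W j) + 2 * k ^ 2 := by grw [hK, finrank_finset_sup_le]
    _ ≤ Iᶜ.card • SG F m d + 2 * k ^ 2 := by grw [Finset.sum_le_card_nsmul _ _ _ hW]
    _ = 2 * k ^ 2 + (k - C.indFanin) * SG F m d := by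
      rw [Finset.card_compl, Fintype.card_fin, hIcard, smul_eq_mul, add_comm]

theorem mainTheorem2 {F : Type*} [Field F] {n k d k' : ℕ} (hF : (d : ℕ∞) < ENat.card F)
    (C : DepthThree.Circuit F n k d) (hid : C.IsIdentity) (hsimple : C.IsSimple)
    (hmin : C.IsMinimal) (hk' : C.indFanin = k') :
    C.rank ≤ 2 * k ^ 2 + (k - k') * DepthThree.SG F k' d ∧
      C.rank ≤ 2 * k ^ 2 + k * DepthThree.SG F k d := by
  subst hk'
  exact ⟨mainTheorem2_general C hid hsimple hmin le_rfl,
    (mainTheorem2_general C hid hsimple hmin C.indFanin_le).trans (by grw [Nat.sub_le])⟩
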